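/- **Setting.** Let $X$ be a connected compact complex manifold of dimension $n$ with an ample line bundle $L$, put $V_k=H^0(X,kL)$ for $k\ge 0$, and let $dV$ be a smooth positive volume form on $X$. Let $\phi$ be a continuous positive metric on $L$ (its local weights are continuous and plurisubharmonic), with norms on $V_k$ $$\|s\|_{k\phi,\infty}=\sup_X|s|e^{-k\phi},\qquad \|s\|_{k\phi}^2=\int_X |s|^2e^{-2k\phi}\,dV .$$ Let $\|\cdot\|^{NA}_\bullet$ be a bounded graded non-Archimedean norm on the section ring: each $\|\cdot\|^{NA}_k$ is an ultrametric norm on $V_k$ for the trivial absolute value of $\mathbb C$, $\|s\cdot t\|^{NA}_{k+m}\le\|s\|^{NA}_k\|t\|^{NA}_m$ for $s\in V_k$, $t\in V_m$, and for some $\delta>0$ one has $e^{-\delta k}\le\|s\|_k^{NA}\le e^{\delta k}$ for all $k$ and all $0\ne s\in V_k$. For each $k$ let $(s_{i,k})_i$ be a basis of $V_k$ that is orthogonal for $\|\cdot\|^{NA}_k$, i.e. $\|\sum_i c_is_{i,k}\|^{NA}_k=\max_{c_i\neq0}\|s_{i,k}\|_k^{NA}$; for $k\ge1$ put $\lambda_{i,k}=-k^{-1}\log\|s_{i,k}\|^{NA}_k$.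 Let $\sigma=\lim_k k^{-n}\sum_i\delta_{\lambda_{i,k}}$ (weak limit) be the Duistermaat–Heckman measure, and let $D\subset\mathbb R$ be the smallest interval containing the support of $\sigma$ and all $\lambda_{i,k}$, $k\ge1$ (so $D=\operatorname{supp}\sigma$ when all $\lambda_{i,k}$ lie in $\operatorname{supp}\sigma$). Let $\mathfrak f:D\to\mathbb R$ be bounded, convex and decreasing (in the wide sense). Fix $\theta\in\{0,1\}$. Let $\|\cdot\|^{NA}_{k,\mathfrak f}$ be the non-Archimedean norm on $V_k$ that has $(s_{i,k})_i$ as an orthogonal basis and satisfies $$\|s_{i,k}\|^{NA}_{k,\mathfrak f}=\big(\|s_{i,k}\|^{NA}_k\big)^{\theta}\,e^{k\,\mathfrak f(\lambda_{i,k})}\quad(k\ge1),\qquad \|s_{i,0}\|^{NA}_{0,\mathfrak f}=1 .$$ Define, for $w\in V_k$, $$\iota^1(\|\cdot\|_{k\phi,\infty},\mathfrak f)(w)=\inf\Big\{\sum_j\|w_j\|_{k\phi,\infty}\,\|w_j\|^{NA}_{k,\mathfrak f}\;:\;w=\sum_j w_j\text{ a finite sum in }V_k\Big\},$$ $$\iota(\|\cdot\|_{k\phi},\mathfrak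 f)\Big(\sum_i c_is_{i,k}\Big)=\Big(\sum_i|c_i|^2\,\|s_{i,k}\|_{k\phi}^2\,\big(\|s_{i,k}\|^{NA}_{k,\mathfrak f}\big)^2\Big)^{1/2}.$$ For norms $p,p'$ on $V_k$ put $\lambda_i(p,p')=\sup_{\dim W=i}\inf_{0\ne w\in W}\log\frac{p'(w)}{p(w)}$ (with $W$ ranging over the subspaces of $V_k$) and $d_\infty(p,p')=\max_{1\le i\le\dim V_k}|\lambda_i(p,p')|$. **Theorem.** For each $\theta\in\{0,1\}$: 1. $\iota^1(\|\cdot\|_{\bullet\phi,\infty},\mathfrak f)$ is a bounded graded norm: it is a norm on $V_k$ for every $k\geq 0$; for all $k,m\ge0$, $s\in V_k$, $t\in V_m$, $$\iota^1(\|\cdot\|_{(k+m)\phi,\infty},\mathfrak f)(s\cdot t)\le\iota^1(\|\cdot\|_{k\phi,\infty},\mathfrak f)(s)\;\iota^1(\|\cdot\|_{m\phi,\infty},\mathfrak f)(t);$$ and there is a bounded positive metric $\psi$ on $L$ with $\limsup_k k^{-1}d_\infty\big(\iota^1(\|\cdot\|_{k\phi,\infty},\mathfrak f),\|\cdot\|_{k\psi,\infty}\big)<\infty$.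 2. If moreover, for every $k$, the basis $(s_{i,k})_i$ is orthogonal for the Hermitian norm $\|\cdot\|_{k\phi}$, then each $\iota(\|\cdot\|_{k\phi},\mathfrak f)$ is a Hermitian norm on $V_k$ with orthogonal basis $(s_{i,k})_i$, and the sequence $\iota(\|\cdot\|_{\bullet\phi},\mathfrak f)$ is Bernstein–Markov with respect to $\iota^1(\|\cdot\|_{\bullet\phi,\infty},\mathfrak f)$: for every $\varepsilon>0$ there is $C_\varepsilon>1$ such that for all $k\ge0$, on $V_k$, $$C_\varepsilon^{-1}e^{-\varepsilon k}\,\iota^1(\|\cdot\|_{k\phi,\infty},\mathfrak f)\;\le\;\iota(\|\cdot\|_{k\phi},\mathfrak f)\;\le\;C_\varepsilon e^{\varepsilon k}\,\iota^1(\|\cdot\|_{k\phi,\infty},\mathfrak f).$$ -/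

import Mathlib

open Set Filter Topology MeasureTheory
open scoped Manifold ContDiff

noncomputable section

namespace Quantisation

/-! ## Holomorphic line bundles, their powers and their sections -/

/-- The model space of an `n`-dimensional complex manifold. -/
abbrev Cn (n : ℕ) : Type := EuclideanSpace ℂ (Fin n)

section Bundle

variable {n : ℕ} {X : Type*} [TopologicalSpace X] [ChartedSpace (Cn n) X] {ι : Type*}

/-- The tensor power `kL` of a line bundle `L` given by transition functions: its transition
functions are the `k`-th powers of those of `L`, on the same trivialising cover. -/
def powCore (L : VectorBundleCore ℂ X ℂ ι) (k : ℕ) : VectorBundleCore ℂ X ℂ ι where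
  baseSet := L.baseSet
  isOpen_baseSet := L.isOpen_baseSet
  indexAt := L.indexAt
  mem_baseSet_at := L.mem_baseSet_at
  coordChange i j x := (L.coordChange i j x 1) ^ k • ContinuousLinearMap.id ℂ ℂ
  coordChange_self i x hx v := by simp [L.coordChange_self i x hx]
  continuousOn_coordChange i j :=
    (((L.continuousOn_coordChange i j).clm_apply continuousOn_const).pow k).smul continuousOn_const
  coordChange_comp i j l x hx v := by
    have h : L.coordChange j l x 1 * L.coordChange i j x 1 = L.coordChange i l x 1 := by
      rw [← L.coordChange_comp i j l x hx 1]
      conv_rhs => rw [← mul_one (L.coordChange i j x 1), ← smul_eq_mul, map_smul]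
      simp [mul_comm]
    simp [← h, mul_pow, mul_assoc]

instance powCore_isContMDiff (L : VectorBundleCore ℂ X ℂ ι) [L.IsContMDiff 𝓘(ℂ, Cn n) ω]
    (k : ℕ) : (powCore L k).IsContMDiff 𝓘(ℂ, Cn n) ω where
  contMDiffOn_coordChange i j := by
    have h := L.contMDiffOn_coordChange 𝓘(ℂ, Cn n) (n := ω) i j
    exact ((h.clm_apply contMDiffOn_const).pow k).smul contMDiffOn_const

/-- `V_k = H⁰(X, kL)`, the space of holomorphic sections of `kL`. The fibre of
`kL` at `x` is a copy of `ℂ`, through the trivialisation of index `L.indexAt x`. -/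
abbrev Sections (L : VectorBundleCore ℂ X ℂ ι) (k : ℕ) : Type _ :=
  ContMDiffSection 𝓘(ℂ, Cn n) ℂ ω (powCore L k).Fiber

/-- The value at `x` of a section of `kL`, read in the trivialisation of index `L.indexAt x`. -/
def coord {L : VectorBundleCore ℂ X ℂ ι} {k : ℕ} (s : Sections (n := n) L k) (x : X) : ℂ := s x

/-- The coordinate of a section of `kL` in the trivialisation of index `i`
(meaningful on `L.baseSet i`). -/
def localRep (L : VectorBundleCore ℂ X ℂ ι) {k : ℕ} (s : Sections (n := n) L k) (i : ι) (x : X) :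
    ℂ :=
  (powCore L k).coordChange (L.indexAt x) i x (coord s x)

/-- The product `V_k × V_m → V_{k+m}` of the section ring of `L`. -/
def mulSection (L : VectorBundleCore ℂ X ℂ ι) {k m : ℕ} (s : Sections (n := n) L k)
    (t : Sections (n := n) L m) : Sections (n := n) L (k + m) where
  toFun x := (coord s x * coord t x : ℂ)
  contMDiff_toFun := by
    intro x₀
    have hs := (Bundle.contMDiffAt_section x₀).1 (s.contMDiff x₀)
    have ht := (Bundle.contMDiffAt_section x₀).1 (t.contMDiff x₀)
    refine (Bundle.contMDiffAt_section x₀).2 ?_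
    refine (ContMDiffAt.mul hs ht).congr_of_eventuallyEq (Eventually.of_forall fun x => ?_)
    change (L.coordChange (L.indexAt x) (L.indexAt x₀) x 1) ^ (k + m) • (coord s x * coord t x) =
      ((L.coordChange (L.indexAt x) (L.indexAt x₀) x 1) ^ k • coord s x) *
        ((L.coordChange (L.indexAt x) (L.indexAt x₀) x 1) ^ m • coord t x)
    simp only [smul_eq_mul]
    ring

/-- Some positive power `kL` is very ample: its sections have no common zero, separate points,
and separate tangent directions. -/
def IsAmple (L : VectorBundleCore ℂ X ℂ ι) : Prop :=
  ∃ k : ℕ, 1 ≤ k ∧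
    (∀ x : X, ∃ s : Sections (n := n) L k, coord s x ≠ 0) ∧
    (∀ x y : X, x ≠ y → ∃ s : Sections (n := n) L k, coord s x = 0 ∧ coord s y ≠ 0) ∧
    (∀ (x : X) (v : TangentSpace 𝓘(ℂ, Cn n) x), v ≠ 0 → ∃ s : Sections (n := n) L k,
      coord s x = 0 ∧
        (mfderiv 𝓘(ℂ, Cn n) 𝓘(ℂ, ℂ) (localRep L s (L.indexAt x)) x v : ℂ) ≠ 0)

/-! ## Metrics on a line bundle -/

/-- A metric `|·| e^{-φ}` on `L`, in additive notation: in the trivialisation `i` the metric is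
`|·| e^{-φ_i}`, and these agree on overlaps. -/
structure LineMetric (L : VectorBundleCore ℂ X ℂ ι) where
  /-- the weight `φ_i` in the trivialisation `i`, meaningful on `L.baseSet i` -/
  weight : ι → X → ℝ
  compat : ∀ i j, ∀ x ∈ L.baseSet i ∩ L.baseSet j,
    weight j x = weight i x + Real.log ‖L.coordChange i j x 1‖

/-- Continuous metrics. -/
def LineMetric.IsContinuous {L : VectorBundleCore ℂ X ℂ ι} (φ : LineMetric L) : Prop :=
  ∀ i, ContinuousOn (φ.weight i) (L.baseSet i)

/-- Bounded metrics on a bundle over a compact base: the weights are locally bounded. -/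
def LineMetric.IsBdd {L : VectorBundleCore ℂ X ℂ ι} (φ : LineMetric L) : Prop :=
  ∀ i, ∀ x ∈ L.baseSet i, ∃ C : ℝ, ∀ᶠ y in 𝓝 x, |φ.weight i y| ≤ C

variable (n) in
/-- A (locally bounded) real function `u` is plurisubharmonic on the open set `U`: it is upper
semicontinuous and, in every chart, satisfies the sub-mean value inequality on all affine discs. -/
def IsPSHOn (u : X → ℝ) (U : Set X) : Prop :=
  UpperSemicontinuousOn u U ∧
    ∀ e ∈ atlas (Cn n) X, ∀ z w : Cn n,
      (∀ ζ : ℂ, ‖ζ‖ ≤ 1 → z + ζ • w ∈ e.target ∧ e.symm (z + ζ • w) ∈ U) →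
        u (e.symm z) ≤ Real.circleAverage (fun ζ : ℂ => u (e.symm (z + ζ • w))) 0 1

variable (n) in
/-- Positive metrics: the weights are plurisubharmonic. (Used for bounded metrics only.) -/
def LineMetric.IsPositive {L : VectorBundleCore ℂ X ℂ ι} (φ : LineMetric L) : Prop :=
  ∀ i, IsPSHOn n (φ.weight i) (L.baseSet i)

/-- The pointwise norm `|s| e^{-kφ}` of a section of `kL`. -/
def pointNorm {L : VectorBundleCore ℂ X ℂ ι} (φ : LineMetric L) {k : ℕ}
    (s : Sections (n := n) L k) (x : X) : ℝ :=
  ‖coord s x‖ * Real.exp (-(k * φ.weight (L.indexAt x) x))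

/-- The sup-norm `‖s‖_{kφ,∞} = sup_X |s| e^{-kφ}`. -/
def supNorm {L : VectorBundleCore ℂ X ℂ ι} (φ : LineMetric L) (k : ℕ)
    (s : Sections (n := n) L k) : ℝ :=
  ⨆ x, pointNorm φ s x

/-- The `L²`-norm `‖s‖_{kφ}`, with `‖s‖_{kφ}² = ∫_X (|s| e^{-kφ})² dV`. -/
def l2Norm {L : VectorBundleCore ℂ X ℂ ι} [MeasurableSpace X] (dV : Measure X) (φ : LineMetric L)
    (k : ℕ) (s : Sections (n := n) L k) : ℝ :=
  Real.sqrt (∫ x, pointNorm φ s x ^ 2 ∂dV)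

variable (n) in
/-- `dV` is (the measure of) a smooth positive volume form: in every chart it has a smooth positive
density with respect to Lebesgue measure. -/
def IsSmoothVolume [MeasurableSpace X] (dV : Measure X) : Prop :=
  ∀ e ∈ atlas (Cn n) X, ∃ ρ : Cn n → ℝ, ContDiffOn ℝ ∞ ρ e.target ∧ (∀ z ∈ e.target, 0 < ρ z) ∧
    ∀ B ⊆ e.target, MeasurableSet B →
      dV (e.source ∩ e ⁻¹' B) = ∫⁻ z in B, ENNReal.ofReal (ρ z)

end Bundle

/-! ## Norms on a complex vector space -/

section Norms

variable {V : Type*} [AddCommGroup V] [Module ℂ V]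

/-- `p` is a norm on the complex vector space `V`. -/
structure IsNorm (p : V → ℝ) : Prop where
  eq_zero_iff : ∀ v, p v = 0 ↔ v = 0
  smul : ∀ (c : ℂ) v, p (c • v) = ‖c‖ * p v
  add_le : ∀ v w, p (v + w) ≤ p v + p w

/-- The basis `b` is orthogonal, in the Hermitian sense, for `p`. Together with `IsNorm p` this says
that `p` belongs to the apartment of `b`; in particular `p` is then a Hermitian norm. -/
def IsHermOrthogonal {N : ℕ} (b : Module.Basis (Fin N) ℂ V) (p : V → ℝ) : Prop :=
  ∀ v, p v ^ 2 = ∑ i, ‖b.repr v i‖ ^ 2 * p (b i) ^ 2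

/-- The successive minimum
`λ_i(p, p') = sup_{W ∈ Grass_i(V)} inf_{w ∈ W \ {0}} log (p' w / p w)`. -/
def succMin (p p' : V → ℝ) (i : ℕ) : ℝ :=
  ⨆ W : {W : Submodule ℂ V // Module.finrank ℂ W = i},
    ⨅ w : {w : V // w ∈ W.1 ∧ w ≠ 0}, Real.log (p' w / p w)

/-- `d_∞(p, p') = max_{1 ≤ i ≤ dim V} |λ_i(p, p')|`. -/
def dInf (p p' : V → ℝ) : ℝ :=
  ⨆ i : Fin (Module.finrank ℂ V), |succMin p p' (i + 1)|

/-- `p` is a norm on `V` with respect to the trivial absolute value on `ℂ`, satisfying the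
ultrametric inequality. -/
structure IsNANorm (p : V → ℝ) : Prop where
  eq_zero_iff : ∀ v, p v = 0 ↔ v = 0
  nonneg : ∀ v, 0 ≤ p v
  smul : ∀ (c : ℂ), c ≠ 0 → ∀ v, p (c • v) = p v
  add_le : ∀ v w, p (v + w) ≤ max (p v) (p w)

/-- The non-Archimedean norm `∑ cᵢ bᵢ ↦ max_{cᵢ ≠ 0} e^{-aᵢ}` (and `0 ↦ 0`). -/
def naNorm {N : ℕ} (b : Module.Basis (Fin N) ℂ V) (a : Fin N → ℝ) (v : V) : ℝ :=
  ⨆ i, if b.repr v i = 0 then 0 else Real.exp (-a i)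

/-- The basis `b` is orthogonal, in the non-Archimedean sense, for `p`. -/
def IsNAOrthogonal {N : ℕ} (b : Module.Basis (Fin N) ℂ V) (p : V → ℝ) : Prop :=
  ∀ v, p v = naNorm b (fun i => -Real.log (p (b i))) v

/-- `ι_b(p, a)`: the Hermitian norm with orthogonal basis `b` and value `p(bᵢ) e^{-aᵢ}` at `bᵢ`. -/
def hermRescale {N : ℕ} (b : Module.Basis (Fin N) ℂ V) (p : V → ℝ) (a : Fin N → ℝ) (v : V) : ℝ :=
  Real.sqrt (∑ i, ‖b.repr v i‖ ^ 2 * (p (b i) * Real.exp (-a i)) ^ 2)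

/-- `ι¹(p, q)(w)`: the infimum of `∑ᵢ p(wᵢ) q(wᵢ)` over all finite decompositions `w = ∑ᵢ wᵢ`. -/
def envRescale (p q : V → ℝ) (w : V) : ℝ :=
  sInf {r : ℝ | ∃ (m : ℕ) (u : Fin m → V), ∑ i, u i = w ∧ r = ∑ i, p (u i) * q (u i)}

end Norms

/-! ## Sequences of norms on the section ring -/

section Graded

variable {n : ℕ} {X : Type*} [TopologicalSpace X] [ChartedSpace (Cn n) X] {ι : Type*}

/-- Submultiplicativity of a sequence of functions on the graded pieces of the section ring. -/
def IsSubmul (L : VectorBundleCore ℂ X ℂ ι) (p : ∀ k, Sections (n := n) L k → ℝ) : Prop :=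
  ∀ (k m : ℕ) (s : Sections (n := n) L k) (t : Sections (n := n) L m),
    p (k + m) (mulSection L s t) ≤ p k s * p m t

/-- `d_∞(p_•, p'_•) = limsup_k k⁻¹ d_∞(p_k, p'_k) ∈ [0, ∞]`. -/
def dInfSeq (L : VectorBundleCore ℂ X ℂ ι) (p p' : ∀ k, Sections (n := n) L k → ℝ) : ENNReal :=
  limsup (fun k : ℕ => ENNReal.ofReal ((k : ℝ)⁻¹ * dInf (p k) (p' k))) atTop

/-- Bounded graded norms: submultiplicative sequences of norms at finite `d_∞`-distance of the
sup-norms of some bounded positive metric. -/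
structure IsBoundedGradedNorm (L : VectorBundleCore ℂ X ℂ ι)
    (p : ∀ k, Sections (n := n) L k → ℝ) : Prop where
  norm : ∀ k, IsNorm (p k)
  submul : IsSubmul L p
  bounded : ∃ ψ : LineMetric L, ψ.IsBdd ∧ ψ.IsPositive n ∧ dInfSeq L p (fun k => supNorm ψ k) < ⊤

/-- Bounded graded non-Archimedean norms. -/
structure IsBoundedGradedNANorm (L : VectorBundleCore ℂ X ℂ ι)
    (q : ∀ k, Sections (n := n) L k → ℝ) : Prop where
  norm : ∀ k, IsNANorm (q k)
  submul : IsSubmul L q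
  bounded : ∃ δ : ℝ, 0 < δ ∧ ∀ (k : ℕ) (s : Sections (n := n) L k), s ≠ 0 →
    Real.exp (-(δ * k)) ≤ q k s ∧ q k s ≤ Real.exp (δ * k)

/-- The sequence `p'` has the Bernstein–Markov property with respect to `p`. -/
def IsBernsteinMarkov (L : VectorBundleCore ℂ X ℂ ι) (p p' : ∀ k, Sections (n := n) L k → ℝ) :
    Prop :=
  ∀ ε : ℝ, 0 < ε → ∃ C : ℝ, 1 < C ∧ ∀ (k : ℕ) (s : Sections (n := n) L k),
    C⁻¹ * Real.exp (-(ε * k)) * p k s ≤ p' k s ∧ p' k s ≤ C * Real.exp (ε * k) * p k s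

/-- A choice of a (finite) basis of `V_k` for every `k`. -/
abbrev BasisSeq (n : ℕ) {X : Type*} [TopologicalSpace X] [ChartedSpace (Cn n) X] {ι : Type*}
    (L : VectorBundleCore ℂ X ℂ ι) : Type _ :=
  ∀ k, Module.Basis (Fin (Module.finrank ℂ (Sections (n := n) L k))) ℂ (Sections (n := n) L k)

variable {L : VectorBundleCore ℂ X ℂ ι}

/-- The normalised jumping number `-k⁻¹ log ‖s_{i,k}‖^NA`. -/
def jump (q : ∀ k, Sections (n := n) L k → ℝ) (b : BasisSeq n L) (k : ℕ)
    (i : Fin (Module.finrank ℂ (Sections (n := n) L k))) : ℝ :=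
  -((k : ℝ)⁻¹ * Real.log (q k (b k i)))

/-- `σ_k = k⁻ⁿ ∑ᵢ δ_{-k⁻¹ log ‖s_{i,k}‖^NA}`. -/
def sigmaK (q : ∀ k, Sections (n := n) L k → ℝ) (b : BasisSeq n L) (k : ℕ) : FiniteMeasure ℝ :=
  let d : Fin _ → FiniteMeasure ℝ := fun i => ⟨Measure.dirac (jump q b k i), inferInstance⟩
  ((k : NNReal) ^ n)⁻¹ • ∑ i, d i

/-- The Duistermaat–Heckman measure: the weak limit of the measures `σ_k`. -/
def dhMeasure (q : ∀ k, Sections (n := n) L k → ℝ) (b : BasisSeq n L) : FiniteMeasure ℝ :=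
  limUnder atTop (sigmaK q b)

/-- The interval on which the rescaling functions live: the smallest interval that contains the
support of the Duistermaat–Heckman measure and all normalised jumping numbers in degrees `k ≥ 1`.
It is the support itself as soon as the support is an interval containing these numbers. -/
def rescaleDomain (q : ∀ k, Sections (n := n) L k → ℝ) (b : BasisSeq n L) : Set ℝ :=
  convexHull ℝ ((dhMeasure q b : Measure ℝ).support ∪ {t | ∃ k, 1 ≤ k ∧ ∃ i, t = jump q b k i})

/-- The modified norm `‖·‖_{k,f}^NA`: it has `b k` as orthogonal basis, and its value at `s_{i,k}`
is `(‖s_{i,k}‖^NA)^θ · e^{k f(-k⁻¹ log ‖s_{i,k}‖^NA)}`. The exponent `θ ∈ {0, 1}` records whether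
the original norm is kept as a factor (`θ = 1`) or not (`θ = 0`). -/
def modNA (θ : ℕ) (q : ∀ k, Sections (n := n) L k → ℝ) (b : BasisSeq n L) (f : ℝ → ℝ) (k : ℕ) :
    Sections (n := n) L k → ℝ :=
  naNorm (b k) fun i => -Real.log (q k (b k i) ^ θ * Real.exp (k * f (jump q b k i)))

/-- `ι(p_•, f)`: in degree `k`, the rescaling `ι_{b k}(p_k, ‖·‖_{k,f}^NA)`. -/
def hermRescaleSeq (θ : ℕ) (p q : ∀ k, Sections (n := n) L k → ℝ) (b : BasisSeq n L) (f : ℝ → ℝ)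
    (k : ℕ) : Sections (n := n) L k → ℝ :=
  hermRescale (b k) (p k) fun i => -Real.log (modNA θ q b f k (b k i))

/-- `ι¹(p_•, f)`: in degree `k`, the envelope `ι¹(p_k, ‖·‖_{k,f}^NA)`. -/
def envRescaleSeq (θ : ℕ) (p q : ∀ k, Sections (n := n) L k → ℝ) (b : BasisSeq n L) (f : ℝ → ℝ)
    (k : ℕ) : Sections (n := n) L k → ℝ :=
  envRescale (p k) (modNA θ q b f k)

end Graded

end Quantisation

end

open Quantisation

namespace Quantisation

/-! ## Linear algebra of norms -/

section EnvelopeBasic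

variable {V : Type*} [AddCommGroup V] {p q : V → ℝ}

/-! Since `f` is decreasing, `x ↦ x ^ θ * exp (k * f (-k⁻¹ * log x))` is nondecreasing, so it
commutes with the maximum that computes `q k` in an orthogonal basis. The modified norm is therefore
a function of `q k` alone (`modNA_eq`). The normalised logarithm of a product is at least the
weighted mean of those of its factors. Monotonicity and then convexity of `f` turn this into
submultiplicativity (`isSubmul_modNA`), and envelopes inherit it by multiplying decompositions
(`isSubmul_envRescale`). Boundedness of `f` puts the modified norm between `exp (-K * k)` and `exp
(K * k)`, so the envelope stays within these factors of the sup-norm and `ψ = φ` serves as reference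
metric.

For the Bernstein–Markov part, one inequality holds because the rescaled Hermitian norm is a norm
lying below the product of the `L²`-norm and the modified norm; any such norm also lies below the
envelope (`hermRescale_le_mul`, `mul_le_envRescale`). For the other, decompose a section along the
basis. Passing from sup-norms to `L²`-norms costs a subexponential factor (`exists_pointNorm_le`,
from the mean value property on small balls), and passing from a sum to a square root of squares
costs the square root of the dimension. The dimension is itself subexponential, by integrating the
Bergman kernel (`card_le_of_pointNorm_le`). -/

theorem envRescale_le_sum (hp : ∀ v, 0 ≤ p v) (hq : ∀ v, 0 ≤ q v) {κ : Type*} [Fintype κ]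
    (u : κ → V) : envRescale p q (∑ i, u i) ≤ ∑ i, p (u i) * q (u i) := by
  -- General finite index types let disjoint unions and products of decompositions be used without
  -- renumbering.
  let e := Fintype.equivFin κ
  refine csInf_le ⟨0, ?_⟩ ⟨Fintype.card κ, u ∘ e.symm, ?_, ?_⟩
  · rintro r ⟨m, u, -, rfl⟩
    exact Finset.sum_nonneg fun i _ => mul_nonneg (hp _) (hq _)
  · exact e.symm.sum_comp u
  · exact (e.symm.sum_comp fun i => p (u i) * q (u i)).symm

theorem envRescale_le (hp : ∀ v, 0 ≤ p v) (hq : ∀ v, 0 ≤ q v) (w : V) :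
    envRescale p q w ≤ p w * q w := by
  simpa using envRescale_le_sum hp hq (fun _ : Unit => w)

theorem envRescale_zero_le (hp : ∀ v, 0 ≤ p v) (hq : ∀ v, 0 ≤ q v) :
    envRescale p q 0 ≤ 0 := by
  simpa using envRescale_le_sum hp hq (fun i : Empty => (i.elim : V))

theorem le_envRescale {w : V} {r : ℝ}
    (h : ∀ (m : ℕ) (u : Fin m → V), ∑ i, u i = w → r ≤ ∑ i, p (u i) * q (u i)) :
    r ≤ envRescale p q w := by
  refine le_csInf ⟨_, 1, fun _ => w, by simp, rfl⟩ ?_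
  rintro _ ⟨m, u, hu, rfl⟩
  exact h m u hu

theorem envRescale_nonneg (hp : ∀ v, 0 ≤ p v) (hq : ∀ v, 0 ≤ q v) (w : V) :
    0 ≤ envRescale p q w :=
  le_envRescale fun _ _ _ => Finset.sum_nonneg fun _ _ => mul_nonneg (hp _) (hq _)

theorem exists_sum_lt_envRescale_add (p q : V → ℝ) (w : V) {ε : ℝ} (hε : 0 < ε) :
    ∃ (m : ℕ) (u : Fin m → V), ∑ i, u i = w ∧ ∑ i, p (u i) * q (u i) < envRescale p q w + ε := by
  obtain ⟨_, ⟨m, u, hu, rfl⟩, h⟩ := Real.lt_sInf_add_pos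
    (s := {r : ℝ | ∃ (m : ℕ) (u : Fin m → V), ∑ i, u i = w ∧ r = ∑ i, p (u i) * q (u i)})
    ⟨_, 1, fun _ => w, by simp, rfl⟩ hε
  exact ⟨m, u, hu, h⟩

end EnvelopeBasic

section Norms

variable {V : Type*} [AddCommGroup V] [Module ℂ V]

namespace IsNorm

variable {p : V → ℝ}

theorem nonneg (hp : IsNorm p) (v : V) : 0 ≤ p v := by
  have h := hp.add_le v ((-1 : ℂ) • v)
  have h0 : v + (-1 : ℂ) • v = 0 := by simp
  rw [h0, (hp.eq_zero_iff 0).2 rfl, hp.smul] at h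
  simp at h
  linarith

theorem pos (hp : IsNorm p) {v : V} (hv : v ≠ 0) : 0 < p v :=
  lt_of_le_of_ne (hp.nonneg v) fun h => hv ((hp.eq_zero_iff v).1 h.symm)

theorem sum_le (hp : IsNorm p) {κ : Type*} (s : Finset κ) (u : κ → V) :
    p (∑ i ∈ s, u i) ≤ ∑ i ∈ s, p (u i) :=
  Finset.le_sum_of_subadditive p ((hp.eq_zero_iff 0).2 rfl).le hp.add_le s u

end IsNorm

/-! ### Non-Archimedean norms diagonal in a basis -/

section NANorm

variable {N : ℕ} (b : Module.Basis (Fin N) ℂ V) (a : Fin N → ℝ)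

theorem exp_le_naNorm {v : V} {i : Fin N} (h : b.repr v i ≠ 0) :
    Real.exp (-a i) ≤ naNorm b a v := by
  have := le_ciSup (f := fun i => if b.repr v i = 0 then 0 else Real.exp (-a i))
    (Set.finite_range _).bddAbove i
  simp only [if_neg h] at this
  exact this

theorem naNorm_zero : naNorm b a 0 = 0 := by
  simp [naNorm]

theorem naNorm_nonneg (v : V) : 0 ≤ naNorm b a v :=
  Real.iSup_nonneg fun i => by split_ifs <;> positivity

theorem exists_naNorm_eq {v : V} (hv : v ≠ 0) :
    ∃ i, b.repr v i ≠ 0 ∧ naNorm b a v = Real.exp (-a i) := by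
  obtain ⟨j, hj⟩ : ∃ j, b.repr v j ≠ 0 := by
    by_contra! h
    exact hv (b.repr.map_eq_zero_iff.1 (Finsupp.ext h))
  have : Nonempty (Fin N) := ⟨j⟩
  obtain ⟨i, hi⟩ := exists_eq_ciSup_of_finite
    (f := fun i => if b.repr v i = 0 then 0 else Real.exp (-a i))
  have hi' : (if b.repr v i = 0 then 0 else Real.exp (-a i)) = naNorm b a v := hi
  -- A maximiser with zero coordinate would make the supremum `0`, below the positive value at `j`.
  by_cases h : b.repr v i = 0
  · have h1 := exp_le_naNorm b a hj
    rw [← hi', if_pos h] at h1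
    exact absurd h1 (not_le.2 (Real.exp_pos _))
  · exact ⟨i, h, by rw [← hi', if_neg h]⟩

theorem naNorm_basis (i : Fin N) : naNorm b a (b i) = Real.exp (-a i) := by
  obtain ⟨j, hj, h⟩ := exists_naNorm_eq b a (b.ne_zero i)
  rw [b.repr_self, Finsupp.single_apply] at hj
  have : i = j := by by_contra hij; simp [hij] at hj
  rw [h, this]

theorem naNorm_smul {c : ℂ} (hc : c ≠ 0) (v : V) : naNorm b a (c • v) = naNorm b a v := by
  simp [naNorm, hc]

end NANorm

/-! ### Envelopes as norms -/

section Envelope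

variable {p q : V → ℝ}

/-- The triangle inequality for `r` along a decomposition suffices. This is the source of all lower
bounds on envelopes. -/
theorem mul_le_envRescale {r : V → ℝ} (hr : IsNorm r) {c : ℝ} (hc : 0 ≤ c)
    (h : ∀ v, c * r v ≤ p v * q v) (w : V) : c * r w ≤ envRescale p q w := by
  refine le_envRescale fun m u hu => ?_
  calc c * r w ≤ c * ∑ i, r (u i) := by
        rw [← hu]; exact mul_le_mul_of_nonneg_left (hr.sum_le _ _) hc
    _ = ∑ i, c * r (u i) := Finset.mul_sum _ _ _
    _ ≤ _ := Finset.sum_le_sum fun i _ => h _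

/-- Scaling and concatenating decompositions give homogeneity and the triangle inequality; the
uniform lower bound on `q` prevents degeneration, since `c * p` stays below the envelope. -/
theorem isNorm_envRescale (hp : IsNorm p) (hq : ∀ v, 0 ≤ q v)
    (hqs : ∀ c : ℂ, c ≠ 0 → ∀ v, q (c • v) = q v) {c : ℝ} (hc : 0 < c)
    (hcq : ∀ v, v ≠ 0 → c ≤ q v) : IsNorm (envRescale p q) := by
  have hmul : ∀ v, c * p v ≤ p v * q v := fun v => by
    by_cases hv : v = 0
    · simp [hv, (hp.eq_zero_iff 0).2 rfl]
    · rw [mul_comm]; exact mul_le_mul_of_nonneg_left (hcq v hv) (hp.nonneg v)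
  have hsmul : ∀ (c : ℂ), c ≠ 0 → ∀ v, envRescale p q (c • v) ≤ ‖c‖ * envRescale p q v := by
    intro c hc0 v
    refine le_of_forall_pos_le_add fun ε hε => ?_
    have hcn : 0 < ‖c‖ := norm_pos_iff.2 hc0
    obtain ⟨m, u, rfl, h⟩ := exists_sum_lt_envRescale_add p q v (div_pos hε hcn)
    calc envRescale p q (c • ∑ i, u i) = envRescale p q (∑ i, c • u i) := by
          rw [Finset.smul_sum]
      _ ≤ ∑ i, p (c • u i) * q (c • u i) := envRescale_le_sum hp.nonneg hq _
      _ = ‖c‖ * ∑ i, p (u i) * q (u i) := by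
          rw [Finset.mul_sum]
          exact Finset.sum_congr rfl fun i _ => by rw [hp.smul, hqs c hc0, mul_assoc]
      _ ≤ ‖c‖ * (envRescale p q (∑ i, u i) + ε / ‖c‖) :=
          mul_le_mul_of_nonneg_left h.le hcn.le
      _ = _ := by rw [mul_add, mul_div_cancel₀ _ hcn.ne']
  have hzero : envRescale p q 0 = 0 :=
    le_antisymm (envRescale_zero_le hp.nonneg hq) (envRescale_nonneg hp.nonneg hq 0)
  refine ⟨fun v => ⟨fun h => ?_, fun h => h ▸ hzero⟩, fun c v => ?_, fun v w => ?_⟩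
  · by_contra hv
    have := mul_le_envRescale hp hc.le hmul v
    rw [h] at this
    exact absurd this (not_le.2 (mul_pos hc (hp.pos hv)))
  · by_cases hc0 : c = 0
    · simp [hc0, hzero]
    · refine le_antisymm (hsmul c hc0 v) ?_
      -- The reverse inequality is the same one for `c⁻¹`, applied to `c • v`.
      have h := hsmul c⁻¹ (inv_ne_zero hc0) (c • v)
      rw [smul_smul, inv_mul_cancel₀ hc0, one_smul, norm_inv] at h
      rwa [← le_inv_mul_iff₀ (norm_pos_iff.2 hc0)]
  · refine le_of_forall_pos_le_add fun ε hε => ?_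
    obtain ⟨m, u, rfl, h⟩ := exists_sum_lt_envRescale_add p q v (half_pos hε)
    obtain ⟨m', u', rfl, h'⟩ := exists_sum_lt_envRescale_add p q w (half_pos hε)
    have := envRescale_le_sum hp.nonneg hq (Sum.elim u u')
    simp only [Fintype.sum_sum_type, Sum.elim_inl, Sum.elim_inr] at this
    linarith

end Envelope

/-! ### Bounding successive minima -/

section SuccMin

/-- Over an empty index the real supremum is `0` by convention, which is why `0 ≤ C` is assumed. -/
theorem abs_iSup_le_of_abs_le {κ : Sort*} {g : κ → ℝ} {C : ℝ} (hC : 0 ≤ C) (h : ∀ i, |g i| ≤ C) :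
    |⨆ i, g i| ≤ C := by
  rcases isEmpty_or_nonempty κ with hκ | ⟨⟨i⟩⟩
  · simpa [Real.iSup_of_isEmpty] using hC
  · refine abs_le.2 ⟨?_, Real.iSup_le (fun j => (abs_le.1 (h j)).2) hC⟩
    exact (abs_le.1 (h i)).1.trans (le_ciSup ⟨C, by
      rintro _ ⟨j, rfl⟩; exact (abs_le.1 (h j)).2⟩ i)

theorem abs_iInf_le_of_abs_le {κ : Sort*} {g : κ → ℝ} {C : ℝ} (hC : 0 ≤ C) (h : ∀ i, |g i| ≤ C) :
    |⨅ i, g i| ≤ C := by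
  have h1 := abs_iSup_le_of_abs_le hC (g := fun i => -g i) (by simpa using h)
  rwa [show (⨆ i, -g i) = -⨅ i, g i by
    simp only [iInf, Real.sInf_def, iSup, neg_neg]
    congr 1
    ext x
    simp [neg_eq_iff_eq_neg], abs_neg] at h1

theorem dInf_le {p p' : V → ℝ} {C : ℝ} (hC : 0 ≤ C)
    (h : ∀ w, w ≠ 0 → |Real.log (p' w / p w)| ≤ C) : dInf p p' ≤ C := by
  refine Real.iSup_le (fun i => ?_) hC
  exact abs_iSup_le_of_abs_le hC fun W => abs_iInf_le_of_abs_le hC fun w => h w.1 w.2.2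

end SuccMin

/-! ### Hermitian norms diagonal in a basis -/

section Hermitian

variable {N : ℕ} (b : Module.Basis (Fin N) ℂ V)

theorem hermRescale_sq (p : V → ℝ) (a : Fin N → ℝ) (v : V) :
    hermRescale b p a v ^ 2 = ∑ i, ‖b.repr v i‖ ^ 2 * (p (b i) * Real.exp (-a i)) ^ 2 :=
  Real.sq_sqrt (Finset.sum_nonneg fun i _ => by positivity)

theorem hermRescale_nonneg (p : V → ℝ) (a : Fin N → ℝ) (v : V) : 0 ≤ hermRescale b p a v :=
  Real.sqrt_nonneg _

/-- Weighted coordinates map `V` linearly to Euclidean space, from which the norm axioms are pulled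
back. -/
theorem hermRescale_eq_norm (p : V → ℝ) (a : Fin N → ℝ) (v : V) :
    hermRescale b p a v = ‖(WithLp.toLp 2 fun i =>
      ((p (b i) * Real.exp (-a i) : ℝ) : ℂ) * b.repr v i : EuclideanSpace ℂ (Fin N))‖ := by
  rw [EuclideanSpace.norm_eq, hermRescale]
  congr 1
  refine Finset.sum_congr rfl fun i _ => ?_
  simp only [norm_mul, Complex.norm_real, mul_pow, Real.norm_eq_abs, sq_abs]
  ring

theorem isNorm_hermRescale {p : V → ℝ} (hp : ∀ i, 0 < p (b i)) (a : Fin N → ℝ) :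
    IsNorm (hermRescale b p a) := by
  refine ⟨fun v => ?_, fun c v => ?_, fun v w => ?_⟩
  · rw [hermRescale_eq_norm, norm_eq_zero]
    constructor
    · intro h
      refine b.repr.map_eq_zero_iff.1 (Finsupp.ext fun i => ?_)
      have hi := congrArg (fun x : EuclideanSpace ℂ (Fin N) => x i) h
      simpa [(hp i).ne'] using hi
    · rintro rfl
      ext i
      simp
  · rw [hermRescale_eq_norm, hermRescale_eq_norm, ← norm_smul]
    congr 1
    ext i
    simp
    ring
  · simp only [hermRescale_eq_norm]
    refine le_trans (le_of_eq ?_) (norm_add_le _ _)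
    congr 1
    ext i
    simp
    ring

theorem hermRescale_basis {p : V → ℝ} (a : Fin N → ℝ) (i : Fin N) :
    hermRescale b p a (b i) ^ 2 = (p (b i) * Real.exp (-a i)) ^ 2 := by
  rw [hermRescale_sq, Finset.sum_eq_single i]
  · simp
  · intro j _ hj
    simp [hj.symm]
  · simp

theorem isHermOrthogonal_hermRescale (p : V → ℝ) (a : Fin N → ℝ) :
    IsHermOrthogonal b (hermRescale b p a) := fun v => by
  simp only [hermRescale_basis]
  exact hermRescale_sq b p a v

/-- Every weight `exp (-a i)` with nonzero coordinate is at most `naNorm b a v`; once this is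
factored out, orthogonality reassembles `p v ^ 2`. -/
theorem hermRescale_le_mul {p : V → ℝ} (hp : ∀ v, 0 ≤ p v) (hb : IsHermOrthogonal b p)
    (a : Fin N → ℝ) (v : V) : hermRescale b p a v ≤ p v * naNorm b a v := by
  refine Real.sqrt_le_iff.2 ⟨mul_nonneg (hp v) (naNorm_nonneg b a v), ?_⟩
  rw [mul_pow, hb v, Finset.sum_mul]
  refine Finset.sum_le_sum fun i _ => ?_
  by_cases h : b.repr v i = 0
  · simp [h]
  · rw [mul_pow, ← mul_assoc]
    gcongr
    exact exp_le_naNorm b a h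

/-- Cauchy–Schwarz against the constant vector `1`. -/
theorem sum_mul_le_sqrt_mul_hermRescale (p : V → ℝ) (a : Fin N → ℝ) (v : V) :
    ∑ i, ‖b.repr v i‖ * (p (b i) * Real.exp (-a i)) ≤ √N * hermRescale b p a v := by
  rw [hermRescale, ← Real.sqrt_mul (Nat.cast_nonneg N)]
  refine Real.le_sqrt_of_sq_le ?_
  have := sq_sum_le_card_mul_sum_sq (s := Finset.univ)
    (f := fun i => ‖b.repr v i‖ * (p (b i) * Real.exp (-a i)))
  simpa [mul_pow] using this

end Hermitian

end Norms

section Bundle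

variable {n : ℕ} {X : Type*} [TopologicalSpace X] [ChartedSpace (Cn n) X] {ι : Type*}
  {L : VectorBundleCore ℂ X ℂ ι} {k m : ℕ}

/-! ## Sections in local trivialisations -/

/-- Evaluation of sections at a point, in the preferred trivialisation at that point. -/
noncomputable def coordLinear (L : VectorBundleCore ℂ X ℂ ι) (k : ℕ) (x : X) :
    Sections (n := n) L k →ₗ[ℂ] ℂ where
  toFun s := coord s x
  map_add' _ _ := rfl
  map_smul' _ _ := rfl

theorem coord_sum {κ : Type*} (t : Finset κ) (u : κ → Sections (n := n) L k) (x : X) :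
    coord (∑ i ∈ t, u i) x = ∑ i ∈ t, coord (u i) x :=
  map_sum (coordLinear L k x) u t

theorem coord_smul (c : ℂ) (s : Sections (n := n) L k) (x : X) :
    coord (c • s) x = c * coord s x := rfl

theorem coord_add (s t : Sections (n := n) L k) (x : X) :
    coord (s + t) x = coord s x + coord t x := rfl

theorem coord_zero (x : X) : coord (0 : Sections (n := n) L k) x = 0 := rfl

theorem coord_mulSection (s : Sections (n := n) L k) (t : Sections (n := n) L m) (x : X) :
    coord (mulSection L s t) x = coord s x * coord t x := rfl

theorem section_ext {s t : Sections (n := n) L k} (h : ∀ x, coord s x = coord t x) : s = t :=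
  ContMDiffSection.ext h

theorem mulSection_sum {κ κ' : Type*} [Fintype κ] [Fintype κ'] (u : κ → Sections (n := n) L k)
    (v : κ' → Sections (n := n) L m) :
    mulSection L (∑ i, u i) (∑ j, v j) = ∑ z : κ × κ', mulSection L (u z.1) (v z.2) := by
  refine section_ext fun x => ?_
  simp only [coord_sum, coord_mulSection, Finset.sum_mul_sum, Fintype.sum_prod_type]

theorem coordChange_one_ne_zero (L : VectorBundleCore ℂ X ℂ ι) {i j : ι} {x : X}
    (hi : x ∈ L.baseSet i) (hj : x ∈ L.baseSet j) : L.coordChange i j x 1 ≠ 0 := by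
  intro h
  have h1 := L.coordChange_comp i j i x ⟨⟨hi, hj⟩, hi⟩ 1
  rw [h, map_zero, L.coordChange_self i x hi] at h1
  exact zero_ne_one h1

theorem localRep_eq (s : Sections (n := n) L k) (i : ι) (x : X) :
    localRep L s i x = L.coordChange (L.indexAt x) i x 1 ^ k * coord s x := by
  simp [localRep, powCore]

theorem contMDiffOn_localRep [L.IsContMDiff 𝓘(ℂ, Cn n) ω] (s : Sections (n := n) L k) (i : ι) :
    ContMDiffOn 𝓘(ℂ, Cn n) 𝓘(ℂ, ℂ) ω (localRep L s i) (L.baseSet i) := by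
  have : MemTrivializationAtlas ((powCore L k).localTriv i) := ⟨⟨i, rfl⟩⟩
  have h := (((powCore L k).localTriv i).contMDiffOn_section_baseSet_iff (IB := 𝓘(ℂ, Cn n))
    (n := ω) (s := s)).1 s.contMDiff.contMDiffOn
  exact h

/-- The index `L.indexAt x` may jump with `x`; continuity and local estimates need one fixed
trivialisation. The `k`-th power of the transition function cancels against the change of weight. -/
theorem pointNorm_eq (φ : LineMetric L) (s : Sections (n := n) L k) {i : ι} {x : X}
    (hx : x ∈ L.baseSet i) :
    pointNorm φ s x = ‖localRep L s i x‖ * Real.exp (-(k * φ.weight i x)) := by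
  have hc := coordChange_one_ne_zero L (L.mem_baseSet_at x) hx
  rw [φ.compat (L.indexAt x) i x ⟨L.mem_baseSet_at x, hx⟩, localRep_eq, pointNorm, norm_mul,
    norm_pow, mul_add, neg_add, Real.exp_add, Real.exp_neg (k * Real.log _), Real.exp_nat_mul,
    Real.exp_log (norm_pos_iff.2 hc)]
  have := pow_ne_zero k (norm_ne_zero_iff.2 hc)
  field_simp

theorem pointNorm_nonneg (φ : LineMetric L) (s : Sections (n := n) L k) (x : X) :
    0 ≤ pointNorm φ s x := by
  unfold pointNorm
  positivity

theorem pointNorm_mulSection (φ : LineMetric L) (s : Sections (n := n) L k)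
    (t : Sections (n := n) L m) (x : X) :
    pointNorm φ (mulSection L s t) x = pointNorm φ s x * pointNorm φ t x := by
  simp only [pointNorm, coord_mulSection, norm_mul, Nat.cast_add, add_mul, neg_add, Real.exp_add]
  ring

theorem continuous_pointNorm [L.IsContMDiff 𝓘(ℂ, Cn n) ω] {φ : LineMetric L}
    (hφ : φ.IsContinuous) (s : Sections (n := n) L k) : Continuous (pointNorm φ s) := by
  refine continuous_iff_continuousAt.2 fun x => ?_
  have hx := L.mem_baseSet_at x
  have hU := (L.isOpen_baseSet (L.indexAt x)).mem_nhds hx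
  have h : ContinuousOn (fun y => ‖localRep L s (L.indexAt x) y‖ *
      Real.exp (-(k * φ.weight (L.indexAt x) y))) (L.baseSet (L.indexAt x)) :=
    (contMDiffOn_localRep s _).continuousOn.norm.mul
      (Real.continuous_exp.comp_continuousOn (continuousOn_const.mul (hφ _)).neg)
  exact (h.congr fun y hy => pointNorm_eq φ s hy).continuousAt hU

theorem LineMetric.IsContinuous.isBdd {φ : LineMetric L} (hφ : φ.IsContinuous) : φ.IsBdd := by
  intro i x hx
  have h := ((hφ i).continuousAt ((L.isOpen_baseSet i).mem_nhds hx)).abs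
  exact ⟨|φ.weight i x| + 1, (h.eventually_lt continuousAt_const (lt_add_one _)).mono
    fun _ => le_of_lt⟩

/-! ## The supremum norms -/

theorem supNorm_le (φ : LineMetric L) {s : Sections (n := n) L k} {C : ℝ} (hC : 0 ≤ C)
    (h : ∀ x, pointNorm φ s x ≤ C) : supNorm φ k s ≤ C :=
  Real.iSup_le h hC

section Sup

variable [CompactSpace X] [L.IsContMDiff 𝓘(ℂ, Cn n) ω] {φ : LineMetric L}

theorem pointNorm_le_supNorm (hφ : φ.IsContinuous) (s : Sections (n := n) L k) (x : X) :
    pointNorm φ s x ≤ supNorm φ k s :=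
  le_ciSup (isCompact_range (continuous_pointNorm hφ s)).bddAbove x

theorem isNorm_supNorm (hφ : φ.IsContinuous) (k : ℕ) :
    IsNorm (supNorm (n := n) φ k) := by
  refine ⟨fun s => ⟨fun h => section_ext fun x => ?_, ?_⟩, fun c s => ?_, fun s t => ?_⟩
  · have h1 := pointNorm_le_supNorm hφ s x
    rw [h] at h1
    have h2 := le_antisymm h1 (pointNorm_nonneg φ s x)
    simpa [pointNorm, coord_zero] using h2
  · rintro rfl
    simp [supNorm, pointNorm, coord_zero]
  · simp only [supNorm, pointNorm, coord_smul, norm_mul, mul_assoc]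
    exact (Real.mul_iSup_of_nonneg (norm_nonneg c) _).symm
  · have h0 (s : Sections (n := n) L k) : 0 ≤ supNorm φ k s :=
      Real.iSup_nonneg (pointNorm_nonneg φ s)
    refine supNorm_le φ (add_nonneg (h0 s) (h0 t)) fun x => ?_
    refine le_trans ?_ (add_le_add (pointNorm_le_supNorm hφ s x) (pointNorm_le_supNorm hφ t x))
    simp only [pointNorm, coord_add, ← add_mul]
    gcongr
    exact norm_add_le _ _

theorem isSubmul_supNorm (hφ : φ.IsContinuous) :
    IsSubmul L (fun k => supNorm (n := n) φ k) := by
  intro k m s t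
  have hs := (isNorm_supNorm hφ k).nonneg s
  refine supNorm_le φ (mul_nonneg hs ((isNorm_supNorm hφ m).nonneg t)) fun x => ?_
  rw [pointNorm_mulSection]
  exact mul_le_mul (pointNorm_le_supNorm hφ s x) (pointNorm_le_supNorm hφ t x)
    (pointNorm_nonneg φ t x) hs

end Sup

end Bundle

/-! ## The mean value property on balls -/

section MeanValue

variable {n : ℕ}

/-- Multiplication by a unit complex number is a real linear isometry, so it preserves both the ball
and Lebesgue measure. -/
theorem setIntegral_closedBall_rotate (g : Cn n → ℂ) (z : Cn n) (r : ℝ) {c : ℂ} (hc : ‖c‖ = 1) :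
    ∫ v in Metric.closedBall 0 r, g (z + c • v) = ∫ y in Metric.closedBall z r, g y := by
  have hc0 : c ≠ 0 := norm_ne_zero_iff.1 (by rw [hc]; exact one_ne_zero)
  let T : Cn n ≃ₗᵢ[ℝ] Cn n :=
    { (LinearEquiv.smulOfNeZero ℂ (Cn n) c hc0).restrictScalars ℝ with
      norm_map' := fun v => by
        change ‖c • v‖ = ‖v‖
        rw [norm_smul, hc, one_mul] }
  have hT : MeasurePreserving (fun v => z + c • v) (volume : Measure (Cn n)) volume :=
    (measurePreserving_add_left volume z).comp T.measurePreserving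
  have hemb : MeasurableEmbedding fun v : Cn n => z + c • v :=
    ((Homeomorph.addLeft z).measurableEmbedding).comp T.toHomeomorph.measurableEmbedding
  rw [← hT.setIntegral_preimage_emb hemb g]
  congr 2
  ext v
  simp [norm_smul, hc, dist_eq_norm]

theorem circleAverage_line {g : Cn n → ℂ} {z v : Cn n} {r : ℝ}
    (hg : ∀ y ∈ Metric.closedBall z r, DifferentiableAt ℂ g y) (hv : ‖v‖ ≤ r) :
    Real.circleAverage (fun ζ : ℂ => g (z + ζ • v)) 0 1 = g z := by
  rw [DiffContOnCl.circleAverage]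
  · simp
  · refine DifferentiableOn.diffContOnCl fun ζ hζ => ?_
    rw [abs_one, closure_ball _ one_ne_zero, mem_closedBall_zero_iff] at hζ
    refine DifferentiableAt.differentiableWithinAt ?_
    refine DifferentiableAt.comp ζ (hg _ ?_) (by fun_prop)
    rw [mem_closedBall_iff_norm, add_sub_cancel_left, norm_smul]
    nlinarith [norm_nonneg v, norm_nonneg ζ]

/-- Averaging the integral over all rotations `v ↦ ζ • v` and exchanging the integrals reduces the
statement to the one-variable mean value property on each complex line through `z`. -/
theorem setIntegral_closedBall_eq {g : Cn n → ℂ} {z : Cn n} {r : ℝ}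
    (hg : ∀ y ∈ Metric.closedBall z r, DifferentiableAt ℂ g y) :
    ∫ y in Metric.closedBall z r, g y = volume.real (Metric.closedBall z r) • g z := by
  set B : Set (Cn n) := Metric.closedBall 0 r
  have hmem : ∀ v ∈ B, ∀ t : ℝ, z + circleMap 0 1 t • v ∈ Metric.closedBall z r := by
    intro v hv t
    rw [mem_closedBall_iff_norm, add_sub_cancel_left, norm_smul, norm_circleMap_zero, abs_one,
      one_mul]
    exact mem_closedBall_zero_iff.1 hv
  have hcont : ContinuousOn (fun p : Cn n × ℝ => g (z + circleMap 0 1 p.2 • p.1))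
      (B ×ˢ Icc 0 (2 * Real.pi)) := by
    have hgc : ContinuousOn g (Metric.closedBall z r) := fun y hy =>
      (hg y hy).continuousAt.continuousWithinAt
    refine hgc.comp (Continuous.continuousOn ?_) fun p hp => hmem p.1 hp.1 p.2
    have := (continuous_circleMap 0 1).comp (continuous_snd (X := Cn n) (Y := ℝ))
    exact continuous_const.add (this.smul continuous_fst)
  have hint : Integrable (Function.uncurry fun (v : Cn n) (t : ℝ) => g (z + circleMap 0 1 t • v))
      ((volume.restrict B).prod (volume.restrict (Ioc 0 (2 * Real.pi)))) := by
    rw [Measure.prod_restrict]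
    exact (hcont.integrableOn_compact ((isCompact_closedBall 0 r).prod isCompact_Icc)).mono_set
      (prod_mono_right Ioc_subset_Icc_self)
  have hvol : volume.real B = volume.real (Metric.closedBall z r) := by
    simp only [B, Measure.real, Measure.addHaar_closedBall_center]
  have hπ : (0 : ℝ) ≤ 2 * Real.pi := by positivity
  calc ∫ y in Metric.closedBall z r, g y
      = (2 * Real.pi)⁻¹ • ∫ t in (0 : ℝ)..2 * Real.pi, ∫ v in B, g (z + circleMap 0 1 t • v) := by
        have h (t : ℝ) := setIntegral_closedBall_rotate g z r (c := circleMap 0 1 t) (by simp)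
        simp only [B, h, intervalIntegral.integral_const, sub_zero, smul_smul]
        rw [inv_mul_cancel₀ (by positivity), one_smul]
    _ = ∫ v in B, Real.circleAverage (fun ζ : ℂ => g (z + ζ • v)) 0 1 := by
        simp only [Real.circleAverage, integral_smul]
        rw [intervalIntegral.integral_of_le hπ, ← integral_integral_swap hint]
        simp only [intervalIntegral.integral_of_le hπ]
    _ = ∫ v in B, g z := setIntegral_congr_fun Metric.isClosed_closedBall.measurableSet
        fun v hv => circleAverage_line hg (mem_closedBall_zero_iff.1 hv)
    _ = _ := by rw [setIntegral_const, hvol]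

/-- The mean value property is applied to the holomorphic function `g ^ 2`. -/
theorem norm_sq_mul_volume_le {g : Cn n → ℂ} {z : Cn n} {r : ℝ}
    (hg : ∀ y ∈ Metric.closedBall z r, DifferentiableAt ℂ g y) :
    ‖g z‖ ^ 2 * volume.real (Metric.closedBall z r) ≤ ∫ y in Metric.closedBall z r, ‖g y‖ ^ 2 := by
  have h := setIntegral_closedBall_eq (g := fun y => g y ^ 2) fun y hy => (hg y hy).pow 2
  calc ‖g z‖ ^ 2 * volume.real (Metric.closedBall z r)
      = ‖∫ y in Metric.closedBall z r, g y ^ 2‖ := by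
        rw [h, norm_smul, norm_pow, Real.norm_of_nonneg measureReal_nonneg, mul_comm]
    _ ≤ ∫ y in Metric.closedBall z r, ‖g y ^ 2‖ := norm_integral_le_integral_norm _
    _ = _ := by simp only [norm_pow]

end MeanValue

/-! ## Smooth volume forms -/

section Volume

variable {n : ℕ} {X : Type*} [TopologicalSpace X] [MeasurableSpace X] {dV : Measure X}

theorem smul_restrict_le_map_chart [BorelSpace X] {e : OpenPartialHomeomorph X (Cn n)}
    {ρ : Cn n → ℝ}
    (hρ : ∀ B ⊆ e.target, MeasurableSet B →
      dV (e.source ∩ e ⁻¹' B) = ∫⁻ z in B, ENNReal.ofReal (ρ z))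
    {A : Set (Cn n)} (hA : A ⊆ e.target) (hAm : MeasurableSet A) {c : ℝ}
    (hc : ∀ z ∈ A, c ≤ ρ z) :
    ENNReal.ofReal c • volume.restrict A ≤ (dV.restrict e.source).map e := by
  have he : AEMeasurable e (dV.restrict e.source) :=
    e.continuousOn.aemeasurable e.open_source.measurableSet
  refine Measure.le_iff.2 fun B hB => ?_
  rw [Measure.map_apply_of_aemeasurable he hB, Measure.smul_apply, Measure.restrict_apply hB,
    Measure.restrict_apply' e.open_source.measurableSet, smul_eq_mul]
  calc ENNReal.ofReal c * volume (B ∩ A) = ∫⁻ _ in B ∩ A, ENNReal.ofReal c := by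
        rw [setLIntegral_const]
    _ ≤ ∫⁻ z in B ∩ A, ENNReal.ofReal (ρ z) :=
        setLIntegral_mono' (hB.inter hAm) fun z hz => ENNReal.ofReal_le_ofReal (hc z hz.2)
    _ = dV (e.source ∩ e ⁻¹' (B ∩ A)) :=
        (hρ _ (inter_subset_right.trans hA) (hB.inter hAm)).symm
    _ ≤ dV (e ⁻¹' B ∩ e.source) := measure_mono fun x hx => ⟨hx.2.1, hx.1⟩

theorem mul_setIntegral_chart_le [BorelSpace X] {e : OpenPartialHomeomorph X (Cn n)}
    {ρ : Cn n → ℝ}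
    (hρ : ∀ B ⊆ e.target, MeasurableSet B →
      dV (e.source ∩ e ⁻¹' B) = ∫⁻ z in B, ENNReal.ofReal (ρ z))
    {A : Set (Cn n)} (hA : A ⊆ e.target) (hAc : IsCompact A) {c : ℝ} (hc0 : 0 ≤ c)
    (hc : ∀ z ∈ A, c ≤ ρ z) {h : X → ℝ} (hh : Continuous h) (h0 : ∀ x, 0 ≤ h x)
    (hi : Integrable h dV) :
    c * ∫ z in A, h (e.symm z) ≤ ∫ x, h x ∂dV := by
  have hint : IntegrableOn (fun z => h (e.symm z)) A :=
    (hh.comp_continuousOn (e.continuousOn_symm.mono hA)).integrableOn_compact hAc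
  rw [← ENNReal.ofReal_le_ofReal_iff (integral_nonneg h0), ENNReal.ofReal_mul hc0,
    ofReal_integral_eq_lintegral_ofReal hint (Eventually.of_forall fun z => h0 _),
    ofReal_integral_eq_lintegral_ofReal hi (Eventually.of_forall h0)]
  calc ENNReal.ofReal c * ∫⁻ z in A, ENNReal.ofReal (h (e.symm z))
      = ∫⁻ z, ENNReal.ofReal (h (e.symm z)) ∂(ENNReal.ofReal c • volume.restrict A) := by
        rw [lintegral_smul_measure, smul_eq_mul]
    _ ≤ ∫⁻ z, ENNReal.ofReal (h (e.symm z)) ∂((dV.restrict e.source).map e) :=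
        lintegral_mono' (smul_restrict_le_map_chart hρ hA hAc.measurableSet hc) le_rfl
    -- This direction of the change of variables needs no measurability of `h ∘ e.symm`, which is
    -- uncontrolled off the target.
    _ ≤ ∫⁻ x in e.source, ENNReal.ofReal (h (e.symm (e x))) ∂dV := lintegral_map_le _ _
    _ = ∫⁻ x in e.source, ENNReal.ofReal (h x) ∂dV :=
        setLIntegral_congr_fun e.open_source.measurableSet fun x hx => by
          simp only [e.left_inv hx]
    _ ≤ _ := setLIntegral_le_lintegral _ _

theorem IsSmoothVolume.isFiniteMeasure [ChartedSpace (Cn n) X] [CompactSpace X]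
    (hdV : IsSmoothVolume n dV) : IsFiniteMeasure dV := by
  refine ⟨isCompact_univ.measure_lt_top_of_nhdsWithin fun x _ => ?_⟩
  rw [nhdsWithin_univ]
  set e := chartAt (Cn n) x
  have hx : x ∈ e.source := mem_chart_source (Cn n) x
  obtain ⟨ρ, hρc, -, hρ⟩ := hdV e (chart_mem_atlas (Cn n) x)
  have ht := e.open_target.mem_nhds (e.map_source hx)
  have hev : ∀ᶠ z in 𝓝 (e x), z ∈ e.target ∧ ρ z < ρ (e x) + 1 :=
    (eventually_mem_set.2 ht).and
      ((hρc.continuousOn.continuousAt ht).eventually_lt continuousAt_const (lt_add_one _))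
  obtain ⟨r, hr, hB⟩ := Metric.nhds_basis_closedBall.eventually_iff.1 hev
  refine ⟨e.source ∩ e ⁻¹' Metric.closedBall (e x) r, ?_, ?_⟩
  · exact inter_mem (e.open_source.mem_nhds hx)
      ((e.continuousAt hx).preimage_mem_nhds (Metric.closedBall_mem_nhds _ hr))
  · have hm : MeasurableSet (Metric.closedBall (e x) r) := Metric.isClosed_closedBall.measurableSet
    rw [hρ _ (fun z hz => (hB hz).1) hm]
    refine (setLIntegral_mono' hm (g := fun _ => ENNReal.ofReal (ρ (e x) + 1)) fun z hz =>
      ENNReal.ofReal_le_ofReal (hB hz).2.le).trans_lt ?_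
    rw [setLIntegral_const]
    exact ENNReal.mul_lt_top ENNReal.ofReal_lt_top (isCompact_closedBall _ _).measure_lt_top

end Volume

/-! ## Comparison of the supremum norms with the `L²`-norms -/

section BernsteinMarkov

variable {n : ℕ} {X : Type*} [TopologicalSpace X] [ChartedSpace (Cn n) X] {ι : Type*}
  {L : VectorBundleCore ℂ X ℂ ι} {k : ℕ}

theorem l2Norm_sq [MeasurableSpace X] (dV : Measure X) (φ : LineMetric L)
    (s : Sections (n := n) L k) : l2Norm dV φ k s ^ 2 = ∫ x, pointNorm φ s x ^ 2 ∂dV :=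
  Real.sq_sqrt (integral_nonneg fun _ => sq_nonneg _)

variable [L.IsContMDiff 𝓘(ℂ, Cn n) ω]

theorem differentiableAt_localRep_chart_symm [IsManifold 𝓘(ℂ, Cn n) ω X]
    (s : Sections (n := n) L k) (i : ι) {e : OpenPartialHomeomorph X (Cn n)}
    (he : e ∈ atlas (Cn n) X) {z : Cn n} (hz : z ∈ e.target) (hzi : e.symm z ∈ L.baseSet i) :
    DifferentiableAt ℂ (fun y => localRep L s i (e.symm y)) z := by
  have h1 : ContMDiffAt 𝓘(ℂ, Cn n) 𝓘(ℂ, Cn n) ω e.symm z :=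
    (contMDiffOn_symm_of_mem_maximalAtlas (IsManifold.subset_maximalAtlas he)).contMDiffAt
      (e.open_target.mem_nhds hz)
  have h2 : ContMDiffAt 𝓘(ℂ, Cn n) 𝓘(ℂ, ℂ) ω (localRep L s i) (e.symm z) :=
    (contMDiffOn_localRep s i).contMDiffAt ((L.isOpen_baseSet i).mem_nhds hzi)
  exact (h2.comp z h1).contDiffAt.differentiableAt (by simp)

variable [CompactSpace X] [MeasurableSpace X] [BorelSpace X] {dV : Measure X} {φ : LineMetric L}

theorem integrable_pointNorm_sq [IsFiniteMeasure dV] (hφ : φ.IsContinuous)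
    (s : Sections (n := n) L k) : Integrable (fun x => pointNorm φ s x ^ 2) dV :=
  ((continuous_pointNorm hφ s).pow 2).integrable_of_hasCompactSupport
    (HasCompactSupport.of_compactSpace _)

theorem l2Norm_le_mul_supNorm [IsFiniteMeasure dV] (hφ : φ.IsContinuous)
    (s : Sections (n := n) L k) :
    l2Norm dV φ k s ≤ √(dV.real univ) * supNorm φ k s := by
  have h0 := (isNorm_supNorm hφ k).nonneg s
  refine Real.sqrt_le_iff.2 ⟨by positivity, ?_⟩
  rw [mul_pow, Real.sq_sqrt measureReal_nonneg]
  calc ∫ x, pointNorm φ s x ^ 2 ∂dV ≤ ∫ _, supNorm φ k s ^ 2 ∂dV :=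
        integral_mono (integrable_pointNorm_sq hφ s) (integrable_const _) fun x =>
          pow_le_pow_left₀ (pointNorm_nonneg φ s x) (pointNorm_le_supNorm hφ s x) 2
    _ = _ := by rw [integral_const, smul_eq_mul]

variable [IsManifold 𝓘(ℂ, Cn n) ω X]

/-- On a small ball the weight oscillates by less than `ε`, so replacing it by its value at the
centre costs at most `exp (ε * k)`. The rest is the mean value inequality on a ball whose radius
does not depend on `k`. -/
theorem exists_nhds_pointNorm_le (hdV : IsSmoothVolume n dV) (hφ : φ.IsContinuous) {ε : ℝ}
    (hε : 0 < ε) (x₀ : X) :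
    ∃ U ∈ 𝓝 x₀, ∃ C : ℝ, ∀ (k : ℕ) (s : Sections (n := n) L k), ∀ x ∈ U,
      pointNorm φ s x ≤ C * Real.exp (ε * k) * l2Norm dV φ k s := by
  have := hdV.isFiniteMeasure
  set e := chartAt (Cn n) x₀
  have he : e ∈ atlas (Cn n) X := chart_mem_atlas (Cn n) x₀
  have hx₀ : x₀ ∈ e.source := mem_chart_source (Cn n) x₀
  obtain ⟨ρ, hρc, hρ0, hρ⟩ := hdV e he
  set i := L.indexAt x₀
  have ht := e.open_target.mem_nhds (e.map_source hx₀)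
  have hsymm : Tendsto e.symm (𝓝 (e x₀)) (𝓝 x₀) := by
    have h : Tendsto e.symm (𝓝 (e x₀)) (𝓝 (e.symm (e x₀))) :=
      e.continuousAt_symm (e.map_source hx₀)
    rwa [e.left_inv hx₀] at h
  have hi := (L.isOpen_baseSet i).mem_nhds (L.mem_baseSet_at x₀)
  have hw : Tendsto (fun z => φ.weight i (e.symm z)) (𝓝 (e x₀)) (𝓝 (φ.weight i x₀)) :=
    ((hφ i).continuousAt hi).tendsto.comp hsymm
  have hρpos := hρ0 _ (e.map_source hx₀)
  have hev : ∀ᶠ z in 𝓝 (e x₀), (z ∈ e.target ∧ e.symm z ∈ L.baseSet i) ∧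
      dist (φ.weight i (e.symm z)) (φ.weight i x₀) < ε / 2 ∧ ρ (e x₀) / 2 < ρ z :=
    ((eventually_mem_set.2 ht).and (hsymm.eventually_mem hi)).and
      ((hw.eventually (Metric.ball_mem_nhds _ (half_pos hε))).and
        (continuousAt_const.eventually_lt (hρc.continuousOn.continuousAt ht) (half_lt_self hρpos)))
  obtain ⟨r, hr, hB⟩ := Metric.nhds_basis_closedBall.eventually_iff.1 hev
  set c := ρ (e x₀) / 2
  have hc : 0 < c := half_pos hρpos
  set v := volume.real (Metric.closedBall (0 : Cn n) (r / 2))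
  have hv : 0 < v := ENNReal.toReal_pos (Metric.measure_closedBall_pos _ _ (half_pos hr)).ne'
    (isCompact_closedBall _ _).measure_lt_top.ne
  -- Points stay within `r / 2` of the centre so that the balls of radius `r / 2` around them remain
  -- in the good ball. The constant collects their volume `v` and the lower bound `c` on the
  -- density.
  refine ⟨e.source ∩ e ⁻¹' Metric.closedBall (e x₀) (r / 2), inter_mem (e.open_source.mem_nhds hx₀)
    ((e.continuousAt hx₀).preimage_mem_nhds (Metric.closedBall_mem_nhds _ (half_pos hr))),
    √(v * c)⁻¹, fun k s x hx => ?_⟩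
  set z := e x
  have hxz : e.symm z = x := e.left_inv hx.1
  have hsub : Metric.closedBall z (r / 2) ⊆ Metric.closedBall (e x₀) r :=
    Metric.closedBall_subset_closedBall' (by linarith [Metric.mem_closedBall.1 hx.2])
  have hzmem := hB (hsub (Metric.mem_closedBall_self (half_pos hr).le))
  set A := Metric.closedBall z (r / 2)
  set w := φ.weight i x
  have hAt : A ⊆ e.target := fun y hy => (hB (hsub hy)).1.1
  have hcont : ContinuousOn (fun y => pointNorm φ s (e.symm y) ^ 2) A :=
    ((continuous_pointNorm hφ s).pow 2).comp_continuousOn (e.continuousOn_symm.mono hAt)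
  have hdiff : ∀ y ∈ A, DifferentiableAt ℂ (fun y => localRep L s i (e.symm y)) y := fun y hy =>
    differentiableAt_localRep_chart_symm s i he (hAt hy) (hB (hsub hy)).1.2
  have hmean := norm_sq_mul_volume_le hdiff
  have hvol : volume.real A = v := Measure.addHaar_real_closedBall_center _ _ _
  rw [hvol, hxz] at hmean
  have hchart := mul_setIntegral_chart_le (h := fun x => pointNorm φ s x ^ 2) hρ hAt
    (isCompact_closedBall z (r / 2)) hc.le (fun y hy => (hB (hsub hy)).2.2.le) ((continuous_pointNorm hφ s).pow 2) (fun _ => sq_nonneg _)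
    (integrable_pointNorm_sq hφ s)
  rw [← l2Norm_sq] at hchart
  -- The weights at `x` and `y` are each within `ε / 2` of the weight at `x₀`, so the one at `y` is
  -- at most `w + ε`.
  have hcomp : ∫ y in A, ‖localRep L s i (e.symm y)‖ ^ 2 ≤
      ∫ y in A, Real.exp (k * (w + ε)) ^ 2 * pointNorm φ s (e.symm y) ^ 2 := by
    refine setIntegral_mono_on ?_ ((hcont.const_mul _).integrableOn_compact
      (isCompact_closedBall _ _)) Metric.isClosed_closedBall.measurableSet fun y hy => ?_
    · have : ContinuousOn (fun y => localRep L s i (e.symm y)) A := fun y hy =>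
        (hdiff y hy).continuousAt.continuousWithinAt
      exact (this.norm.pow 2).integrableOn_compact (isCompact_closedBall _ _)
    · rw [← mul_pow, pointNorm_eq φ s (hB (hsub hy)).1.2]
      refine pow_le_pow_left₀ (norm_nonneg _) ?_ 2
      rw [mul_left_comm, ← Real.exp_add]
      refine le_mul_of_one_le_right (norm_nonneg _) (Real.one_le_exp ?_)
      have h1 := (abs_lt.1 (hB (hsub hy)).2.1).2
      have h2 := hzmem.2.1
      rw [hxz] at h2
      have h3 := (abs_lt.1 h2).1
      have : (0 : ℝ) ≤ k * (w + ε - φ.weight i (e.symm y)) :=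
        mul_nonneg (Nat.cast_nonneg k) (by linarith)
      linarith
  rw [integral_const_mul] at hcomp
  have hxi : x ∈ L.baseSet i := hxz ▸ hzmem.1.2
  have hE : Real.exp (ε * k) = Real.exp (k * (w + ε)) * Real.exp (-(k * w)) := by
    rw [← Real.exp_add]; congr 1; ring
  have hl : 0 ≤ l2Norm dV φ k s := Real.sqrt_nonneg _
  refine le_of_sq_le_sq ?_ (by positivity)
  rw [mul_pow, mul_pow, Real.sq_sqrt (by positivity), pointNorm_eq φ s hxi, hE, mul_pow, mul_pow,
    inv_mul_eq_div, div_mul_eq_mul_div, le_div_iff₀ (by positivity)]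
  have hexp := sq_nonneg (Real.exp (-(k * w)))
  calc ‖localRep L s i x‖ ^ 2 * Real.exp (-(k * w)) ^ 2 * (v * c)
      = (‖localRep L s i x‖ ^ 2 * v) * c * Real.exp (-(k * w)) ^ 2 := by ring
    _ ≤ (Real.exp (k * (w + ε)) ^ 2 * ∫ y in A, pointNorm φ s (e.symm y) ^ 2) * c *
          Real.exp (-(k * w)) ^ 2 :=
        mul_le_mul_of_nonneg_right (mul_le_mul_of_nonneg_right (hmean.trans hcomp) hc.le) hexp
    _ = Real.exp (k * (w + ε)) ^ 2 * Real.exp (-(k * w)) ^ 2 *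
          (c * ∫ y in A, pointNorm φ s (e.symm y) ^ 2) := by ring
    _ ≤ _ := by gcongr

/-- The Bernstein–Markov inequality for continuous metrics and smooth volume forms. -/
theorem exists_pointNorm_le (hdV : IsSmoothVolume n dV) (hφ : φ.IsContinuous) {ε : ℝ}
    (hε : 0 < ε) :
    ∃ C : ℝ, 1 < C ∧ ∀ (k : ℕ) (s : Sections (n := n) L k) (x : X),
      pointNorm φ s x ≤ C * Real.exp (ε * k) * l2Norm dV φ k s := by
  choose U hU C hC using exists_nhds_pointNorm_le (L := L) hdV hφ hε
  obtain ⟨t, -, ht⟩ := isCompact_univ.elim_nhds_subcover U fun x _ => hU x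
  refine ⟨2 + ∑ x ∈ t, |C x|, ?_, fun k s x => ?_⟩
  · have := Finset.sum_nonneg fun x (_ : x ∈ t) => abs_nonneg (C x)
    linarith
  · obtain ⟨y, hy, hxy⟩ := mem_iUnion₂.1 (ht (mem_univ x))
    refine (hC y k s x hxy).trans ?_
    have h1 := Finset.single_le_sum (fun x _ => abs_nonneg (C x)) hy
    have h2 := le_abs_self (C y)
    have hl : 0 ≤ l2Norm dV φ k s := Real.sqrt_nonneg _
    gcongr
    linarith

/-- A vanishing `L²`-norm forces a vanishing sup-norm through the Bernstein–Markov inequality. -/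
theorem l2Norm_pos (hdV : IsSmoothVolume n dV) (hφ : φ.IsContinuous) {s : Sections (n := n) L k}
    (hs : s ≠ 0) : 0 < l2Norm dV φ k s := by
  refine lt_of_le_of_ne (Real.sqrt_nonneg _) fun h => hs ?_
  obtain ⟨C, -, hC⟩ := exists_pointNorm_le (L := L) hdV hφ one_pos
  refine ((isNorm_supNorm hφ k).eq_zero_iff s).1 (le_antisymm ?_ ((isNorm_supNorm hφ k).nonneg s))
  refine supNorm_le φ le_rfl fun x => (hC k s x).trans ?_
  rw [← h, mul_zero]

/-- A bound for the Bergman kernel, integrated over `X`: an orthogonal basis of a space of sections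
has few elements as soon as the supremum norm is controlled by the `L²`-norm. -/
theorem card_le_of_pointNorm_le (hdV : IsSmoothVolume n dV) (hφ : φ.IsContinuous) {N : ℕ}
    (b : Module.Basis (Fin N) ℂ (Sections (n := n) L k))
    (hb : IsHermOrthogonal b (l2Norm dV φ k)) {C : ℝ}
    (hC : ∀ (s : Sections (n := n) L k) (x : X), pointNorm φ s x ≤ C * l2Norm dV φ k s) :
    (N : ℝ) ≤ dV.real univ * C ^ 2 := by
  have := hdV.isFiniteMeasure
  have hpos : ∀ i, 0 < l2Norm dV φ k (b i) := fun i => l2Norm_pos hdV hφ (b.ne_zero i)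
  have key : ∀ x, ∑ i, pointNorm φ (b i) x ^ 2 / l2Norm dV φ k (b i) ^ 2 ≤ C ^ 2 := by
    intro x
    set S := ∑ i, pointNorm φ (b i) x ^ 2 / l2Norm dV φ k (b i) ^ 2 with hS
    set E := Real.exp (-(k * φ.weight (L.indexAt x) x))
    have hE0 : 0 < E := Real.exp_pos _
    -- Coefficients of the reproducing section at `x`: its squared `L²`-norm and its value at `x`
    -- both equal `T`, so applying `hC` to it bounds the Bergman kernel `S`.
    let c : Fin N → ℂ := fun i =>
      (starRingEnd ℂ) (coord (b i) x) / ((l2Norm dV φ k (b i) : ℝ) : ℂ) ^ 2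
    set s := ∑ i, c i • b i
    have hrepr : ∀ i, b.repr s i = c i := fun i => by rw [b.repr_sum_self]
    have hcn : ∀ i, ‖c i‖ = ‖coord (b i) x‖ / l2Norm dV φ k (b i) ^ 2 := fun i => by
      simp only [c, norm_div, RCLike.norm_conj, norm_pow, Complex.norm_real, Real.norm_eq_abs,
        sq_abs]
    set T := ∑ i, ‖coord (b i) x‖ ^ 2 / l2Norm dV φ k (b i) ^ 2 with hT
    have hT0 : 0 ≤ T := Finset.sum_nonneg fun i _ => by positivity
    have hST : S = T * E ^ 2 := by
      rw [hS, hT, Finset.sum_mul]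
      refine Finset.sum_congr rfl fun i _ => ?_
      rw [pointNorm, mul_pow, div_mul_eq_mul_div]
    have hl2 : l2Norm dV φ k s ^ 2 = T := by
      rw [hb s]
      refine Finset.sum_congr rfl fun i _ => ?_
      rw [hrepr, hcn]
      have := (hpos i).ne'
      field_simp
    have hcoord : coord s x = (T : ℂ) := by
      rw [coord_sum, hT, Complex.ofReal_sum]
      refine Finset.sum_congr rfl fun i _ => ?_
      rw [coord_smul, div_mul_eq_mul_div, mul_comm, Complex.mul_conj, Complex.normSq_eq_norm_sq]
      push_cast
      rfl
    have hp : pointNorm φ s x ^ 2 = T * S := by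
      rw [hST, pointNorm, hcoord, Complex.norm_real, Real.norm_of_nonneg hT0]
      ring
    have hle := pow_le_pow_left₀ (pointNorm_nonneg φ s x) (hC s x) 2
    rw [hp, mul_pow, hl2, mul_comm] at hle
    -- When `T = 0` all basis sections vanish at `x` and there is nothing to cancel.
    rcases hT0.eq_or_lt with h | h
    · rw [hST, ← h, zero_mul]; positivity
    · exact le_of_mul_le_mul_right hle h
  have hint : ∀ i, Integrable (fun x => pointNorm φ (b i) x ^ 2 / l2Norm dV φ k (b i) ^ 2) dV :=
    fun i => (integrable_pointNorm_sq hφ (b i)).div_const _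
  calc (N : ℝ) = ∑ i : Fin N, ∫ x, pointNorm φ (b i) x ^ 2 / l2Norm dV φ k (b i) ^ 2 ∂dV := by
        have : ∀ i, ∫ x, pointNorm φ (b i) x ^ 2 / l2Norm dV φ k (b i) ^ 2 ∂dV = 1 := fun i => by
          rw [integral_div, ← l2Norm_sq, div_self (pow_ne_zero 2 (hpos i).ne')]
        simp [this]
    _ = ∫ x, ∑ i, pointNorm φ (b i) x ^ 2 / l2Norm dV φ k (b i) ^ 2 ∂dV :=
        (integral_finsetSum _ fun i _ => hint i).symm
    _ ≤ ∫ _, C ^ 2 ∂dV :=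
        integral_mono (integrable_finsetSum _ fun i _ => hint i) (integrable_const _) key
    _ = _ := by rw [integral_const, smul_eq_mul]

end BernsteinMarkov

section Graded

variable {n : ℕ} {X : Type*} [TopologicalSpace X] [ChartedSpace (Cn n) X] {ι : Type*}
  {L : VectorBundleCore ℂ X ℂ ι}

/-! ## Envelopes on the section ring -/

/-- Products of the terms of two nearly optimal decompositions decompose the product section, and
their total cost is at most the product of the two costs. -/
theorem isSubmul_envRescale {p q : ∀ k, Sections (n := n) L k → ℝ} (hp : IsSubmul L p)
    (hq : IsSubmul L q) (hp0 : ∀ k s, 0 ≤ p k s) (hq0 : ∀ k s, 0 ≤ q k s) :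
    IsSubmul L fun k => envRescale (p k) (q k) := by
  intro k m s t
  set E := envRescale (p k) (q k) s
  set E' := envRescale (p m) (q m) t
  have key : ∀ ε : ℝ, 0 < ε →
      envRescale (p (k + m)) (q (k + m)) (mulSection L s t) ≤ (E + ε) * (E' + ε) := by
    intro ε hε
    obtain ⟨l, u, rfl, hu⟩ := exists_sum_lt_envRescale_add (p k) (q k) s hε
    obtain ⟨l', v, rfl, hv⟩ := exists_sum_lt_envRescale_add (p m) (q m) t hε
    rw [mulSection_sum]
    refine (envRescale_le_sum (hp0 _) (hq0 _) _).trans ?_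
    calc ∑ z : Fin l × Fin l', p (k + m) (mulSection L (u z.1) (v z.2)) *
          q (k + m) (mulSection L (u z.1) (v z.2))
        ≤ ∑ z : Fin l × Fin l', (p k (u z.1) * q k (u z.1)) * (p m (v z.2) * q m (v z.2)) := by
          refine Finset.sum_le_sum fun z _ => ?_
          rw [mul_mul_mul_comm]
          exact mul_le_mul (hp _ _ _ _) (hq _ _ _ _) (hq0 _ _) (mul_nonneg (hp0 _ _) (hp0 _ _))
      _ = (∑ i, p k (u i) * q k (u i)) * ∑ j, p m (v j) * q m (v j) := by
          rw [Finset.sum_mul_sum, Fintype.sum_prod_type]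
      _ ≤ _ := mul_le_mul hu.le hv.le
          (Finset.sum_nonneg fun j _ => mul_nonneg (hp0 _ _) (hq0 _ _))
          (add_nonneg (envRescale_nonneg (hp0 _) (hq0 _) _) hε.le)
  have hlim : Tendsto (fun ε : ℝ => (E + ε) * (E' + ε)) (𝓝[>] 0) (𝓝 (E * E')) := by
    have : Continuous fun ε : ℝ => (E + ε) * (E' + ε) := by fun_prop
    simpa using (this.tendsto 0).mono_left nhdsWithin_le_nhds
  exact ge_of_tendsto hlim (eventually_mem_nhdsWithin.mono fun ε hε => key ε hε)

theorem dInfSeq_lt_top {p p' : ∀ k, Sections (n := n) L k → ℝ} {K : ℝ} (hK : 0 ≤ K)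
    (h : ∀ k s, s ≠ 0 → |Real.log (p' k s / p k s)| ≤ K * k) : dInfSeq L p p' < ⊤ := by
  refine lt_of_le_of_lt (b := ENNReal.ofReal K) ?_ ENNReal.ofReal_lt_top
  refine limsup_le_of_le (by isBoundedDefault) (Eventually.of_forall fun k => ?_)
  refine ENNReal.ofReal_le_ofReal ?_
  have h1 : dInf (p k) (p' k) ≤ K * k := dInf_le (by positivity) (h k)
  rcases k.eq_zero_or_pos with rfl | hk
  · simpa using hK
  · have : (0 : ℝ) < k := Nat.cast_pos.2 hk
    rwa [inv_mul_le_iff₀ this, mul_comm]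

/-! ## Rescaled non-Archimedean norms -/

section Rescaled

variable {q : ∀ k, Sections (n := n) L k → ℝ} {b : BasisSeq n L} {f : ℝ → ℝ} {θ k : ℕ}

theorem IsNANorm.pos {V : Type*} [AddCommGroup V] [Module ℂ V] {p : V → ℝ} (hp : IsNANorm p)
    {v : V} (hv : v ≠ 0) : 0 < p v :=
  lt_of_le_of_ne (hp.nonneg v) fun h => hv ((hp.eq_zero_iff v).1 h.symm)

theorem exists_basis_eq (hq : IsNANorm (q k)) (hbq : IsNAOrthogonal (b k) (q k))
    {s : Sections (n := n) L k} (hs : s ≠ 0) :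
    ∃ i, (b k).repr s i ≠ 0 ∧ q k s = q k (b k i) ∧
      ∀ j, (b k).repr s j ≠ 0 → q k (b k j) ≤ q k (b k i) := by
  have he : ∀ j, Real.exp (- -Real.log (q k (b k j))) = q k (b k j) := fun j => by
    rw [neg_neg, Real.exp_log (hq.pos ((b k).ne_zero j))]
  obtain ⟨i, hi, h⟩ := exists_naNorm_eq (b k) (fun i => -Real.log (q k (b k i))) hs
  rw [← hbq s, he] at h
  refine ⟨i, hi, h, fun j hj => ?_⟩
  have := exp_le_naNorm (b k) (fun i => -Real.log (q k (b k i))) hj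
  rwa [he, ← hbq s, h] at this

theorem jump_mem_rescaleDomain (q : ∀ k, Sections (n := n) L k → ℝ) (b : BasisSeq n L)
    (hk : 1 ≤ k) (i) : jump q b k i ∈ rescaleDomain q b :=
  subset_convexHull ℝ _ (Or.inr ⟨k, hk, i, rfl⟩)

/-- The value of `q k` at a nonzero section is attained on a basis vector, so `f` is only ever
evaluated on its domain. -/
theorem logNorm_mem_rescaleDomain (hq : IsNANorm (q k)) (hbq : IsNAOrthogonal (b k) (q k))
    (hk : 1 ≤ k) {s : Sections (n := n) L k} (hs : s ≠ 0) :
    -((k : ℝ)⁻¹ * Real.log (q k s)) ∈ rescaleDomain q b := by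
  obtain ⟨i, -, h, -⟩ := exists_basis_eq hq hbq hs
  rw [h]
  exact jump_mem_rescaleDomain q b hk i

/-- A nondecreasing function of `q k` attains its maximum over the occurring basis vectors where `q
k` does. In degree `0` the factor `k` removes `f`. -/
theorem modNA_eq (hq : IsNANorm (q k)) (hbq : IsNAOrthogonal (b k) (q k))
    (hfa : AntitoneOn f (rescaleDomain q b)) {s : Sections (n := n) L k} (hs : s ≠ 0) :
    modNA θ q b f k s =
      q k s ^ θ * Real.exp (k * f (-((k : ℝ)⁻¹ * Real.log (q k s)))) := by
  have hpos : ∀ j, 0 < q k (b k j) := fun j => hq.pos ((b k).ne_zero j)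
  have he : ∀ j, Real.exp (- -Real.log (q k (b k j) ^ θ * Real.exp (k * f (jump q b k j)))) =
      q k (b k j) ^ θ * Real.exp (k * f (jump q b k j)) := fun j => by
    rw [neg_neg, Real.exp_log (mul_pos (pow_pos (hpos j) θ) (Real.exp_pos _))]
  obtain ⟨i, hi, hqi, hmax⟩ := exists_basis_eq hq hbq hs
  obtain ⟨j, hj, h⟩ := exists_naNorm_eq (b k)
    (fun i => -Real.log (q k (b k i) ^ θ * Real.exp (k * f (jump q b k i)))) hs
  rw [hqi]
  change modNA θ q b f k s = q k (b k i) ^ θ * Real.exp (k * f (jump q b k i))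
  refine le_antisymm ?_ ?_
  · rw [modNA, h, he]
    have := (hpos j).le
    refine mul_le_mul (pow_le_pow_left₀ this (hmax j hj) θ) (Real.exp_le_exp.2 ?_)
      (Real.exp_pos _).le (pow_nonneg (hpos i).le θ)
    rcases k.eq_zero_or_pos with hk | hk
    · simp [hk]
    · refine mul_le_mul_of_nonneg_left (hfa (jump_mem_rescaleDomain q b hk i)
        (jump_mem_rescaleDomain q b hk j) ?_) (Nat.cast_nonneg k)
      refine neg_le_neg (mul_le_mul_of_nonneg_left ?_ (by positivity))
      exact Real.log_le_log (hpos j) (hmax j hj)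
  · rw [← he]
    exact exp_le_naNorm (b k)
      (fun i => -Real.log (q k (b k i) ^ θ * Real.exp (k * f (jump q b k i)))) hi

theorem modNA_nonneg (θ : ℕ) (q : ∀ k, Sections (n := n) L k → ℝ) (b : BasisSeq n L) (f : ℝ → ℝ)
    (k : ℕ) (s : Sections (n := n) L k) : 0 ≤ modNA θ q b f k s :=
  naNorm_nonneg _ _ _

theorem modNA_zero (θ : ℕ) (q : ∀ k, Sections (n := n) L k → ℝ) (b : BasisSeq n L) (f : ℝ → ℝ)
    (k : ℕ) : modNA θ q b f k 0 = 0 :=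
  naNorm_zero _ _

/-- With `x`, `y` the normalised logarithms of the factors, that of the product is at least `(k * x
+ m * y) / (k + m)`. Monotonicity of `f` moves to this mean, convexity splits it, and multiplying by
`k + m` gives the additive inequality for exponents. -/
theorem isSubmul_modNA (hq : ∀ k, IsNANorm (q k)) (hqm : IsSubmul L q)
    (hq0 : ∀ s : Sections (n := n) L 0, s ≠ 0 → q 0 s = 1)
    (hbq : ∀ k, IsNAOrthogonal (b k) (q k)) (hfc : ConvexOn ℝ (rescaleDomain q b) f)
    (hfa : AntitoneOn f (rescaleDomain q b)) : IsSubmul L (modNA θ q b f) := by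
  intro k m s t
  by_cases hst : mulSection L s t = 0
  · rw [hst, modNA_zero]
    exact mul_nonneg (modNA_nonneg ..) (modNA_nonneg ..)
  have hs : s ≠ 0 := by
    rintro rfl
    exact hst (section_ext fun x => by simp [coord_mulSection, coord_zero])
  have ht : t ≠ 0 := by
    rintro rfl
    exact hst (section_ext fun x => by simp [coord_mulSection, coord_zero])
  rw [modNA_eq (hq _) (hbq _) hfa hst, modNA_eq (hq _) (hbq _) hfa hs,
    modNA_eq (hq _) (hbq _) hfa ht, mul_mul_mul_comm, ← mul_pow, ← Real.exp_add]
  have hst0 := (hq _).pos hst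
  have hs0 := (hq _).pos hs
  have ht0 := (hq _).pos ht
  have hle := hqm k m s t
  refine mul_le_mul (pow_le_pow_left₀ hst0.le hle θ) (Real.exp_le_exp.2 ?_) (Real.exp_pos _).le
    (by positivity)
  have hlog : Real.log (q (k + m) (mulSection L s t)) ≤ Real.log (q k s) + Real.log (q m t) := by
    rw [← Real.log_mul hs0.ne' ht0.ne']
    exact Real.log_le_log hst0 hle
  rcases (k + m).eq_zero_or_pos with h0 | hpos
  · obtain ⟨rfl, rfl⟩ := Nat.add_eq_zero_iff.1 h0
    simp
  have hmst := logNorm_mem_rescaleDomain (hq _) (hbq _) hpos hst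
  have hKM : (0 : ℝ) < k + m := by exact_mod_cast hpos
  push_cast at hmst ⊢
  -- A factor of degree `0` has no jumping number in the domain. Its logarithm is `0` by `hq0`, so
  -- monotonicity alone settles the case.
  rcases k.eq_zero_or_pos with hk | hk
  · have hk' : (k : ℝ) = 0 := by exact_mod_cast hk
    have hs1 : Real.log (q k s) = 0 := by
      subst hk
      rw [hq0 s hs, Real.log_one]
    have hmt := logNorm_mem_rescaleDomain (hq _) (hbq _) (by omega) ht
    simp only [hk', hs1, zero_add, zero_mul] at hlog hmst ⊢
    refine mul_le_mul_of_nonneg_left (hfa hmt hmst ?_) (Nat.cast_nonneg m)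
    exact neg_le_neg (mul_le_mul_of_nonneg_left hlog (by positivity))
  rcases m.eq_zero_or_pos with hm | hm
  · have hm' : (m : ℝ) = 0 := by exact_mod_cast hm
    have ht1 : Real.log (q m t) = 0 := by
      subst hm
      rw [hq0 t ht, Real.log_one]
    have hks := logNorm_mem_rescaleDomain (hq _) (hbq _) hk hs
    simp only [hm', ht1, add_zero, zero_mul] at hlog hmst ⊢
    refine mul_le_mul_of_nonneg_left (hfa hks hmst ?_) (Nat.cast_nonneg k)
    exact neg_le_neg (mul_le_mul_of_nonneg_left hlog (by positivity))
  have hk' : (0 : ℝ) < k := Nat.cast_pos.2 hk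
  have hm' : (0 : ℝ) < m := Nat.cast_pos.2 hm
  have hks := logNorm_mem_rescaleDomain (hq _) (hbq _) hk hs
  have hmt := logNorm_mem_rescaleDomain (hq _) (hbq _) hm ht
  have hsum : (k : ℝ) / (k + m) + m / (k + m) = 1 := by field_simp
  have hconv := hfc.2 hks hmt (by positivity) (by positivity) hsum
  have hmem := hfc.1 hks hmt (by positivity) (by positivity) hsum
  simp only [smul_eq_mul] at hconv hmem
  have hanti := hfa hmem hmst (by
    have : (k : ℝ) / (k + m) * -((k : ℝ)⁻¹ * Real.log (q k s)) +
        m / (k + m) * -((m : ℝ)⁻¹ * Real.log (q m t)) =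
        -(((k : ℝ) + m)⁻¹ * (Real.log (q k s) + Real.log (q m t))) := by
      field_simp
      ring
    rw [this]
    exact neg_le_neg (mul_le_mul_of_nonneg_left hlog (by positivity)))
  calc ((k : ℝ) + m) * f (-(((k : ℝ) + m)⁻¹ * Real.log (q (k + m) (mulSection L s t))))
      ≤ (k + m) * (k / (k + m) * f (-((k : ℝ)⁻¹ * Real.log (q k s))) +
          m / (k + m) * f (-((m : ℝ)⁻¹ * Real.log (q m t)))) :=
        mul_le_mul_of_nonneg_left (hanti.trans hconv) hKM.le
    _ = _ := by field_simp

theorem exists_modNA_bounds (hq : IsBoundedGradedNANorm L q)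
    (hbq : ∀ k, IsNAOrthogonal (b k) (q k)) (hfa : AntitoneOn f (rescaleDomain q b))
    (hfb : ∃ M : ℝ, ∀ t ∈ rescaleDomain q b, |f t| ≤ M) (θ : ℕ) :
    ∃ K : ℝ, 0 ≤ K ∧ ∀ (k : ℕ) (s : Sections (n := n) L k), s ≠ 0 →
      Real.exp (-(K * k)) ≤ modNA θ q b f k s ∧ modNA θ q b f k s ≤ Real.exp (K * k) := by
  obtain ⟨δ, hδ, hqδ⟩ := hq.bounded
  obtain ⟨M, hM⟩ := hfb
  -- The power `θ` of `q` contributes `θ * δ` and the factor from `f` contributes `|M|`; the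
  -- absolute value makes the rate nonnegative.
  refine ⟨θ * δ + |M|, by positivity, fun k s hs => ?_⟩
  have hf : |k * f (-((k : ℝ)⁻¹ * Real.log (q k s)))| ≤ |M| * k := by
    rcases k.eq_zero_or_pos with hk | hk
    · simp [hk]
    · rw [abs_mul, Nat.abs_cast, mul_comm]
      have := (hM _ (logNorm_mem_rescaleDomain (hq.norm k) (hbq k) hk hs)).trans (le_abs_self M)
      gcongr
  obtain ⟨h1, h2⟩ := hqδ k s hs
  obtain ⟨h3, h4⟩ := abs_le.1 hf
  rw [modNA_eq (hq.norm k) (hbq k) hfa hs]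
  constructor
  · calc Real.exp (-((θ * δ + |M|) * k)) = Real.exp (-(δ * k)) ^ θ * Real.exp (-(|M| * k)) := by
          rw [← Real.exp_nat_mul, ← Real.exp_add]
          congr 1
          ring
      _ ≤ _ := by
          have := (hq.norm k).nonneg s
          gcongr
  · calc q k s ^ θ * Real.exp (k * f (-((k : ℝ)⁻¹ * Real.log (q k s))))
        ≤ Real.exp (δ * k) ^ θ * Real.exp (|M| * k) := by
          have := (hq.norm k).nonneg s
          gcongr
      _ = _ := by
          rw [← Real.exp_nat_mul, ← Real.exp_add]
          congr 1
          ring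

end Rescaled

/-! ## Envelopes of supremum norms and rescaled `L²`-norms -/

section Main

theorem hermRescaleSeq_eq (θ : ℕ) (p q : ∀ k, Sections (n := n) L k → ℝ) (b : BasisSeq n L)
    (f : ℝ → ℝ) (k : ℕ) :
    hermRescaleSeq θ p q b f k = hermRescale (b k) (p k) fun i =>
      -Real.log (q k (b k i) ^ θ * Real.exp (k * f (jump q b k i))) := by
  simp only [hermRescaleSeq, modNA, naNorm_basis, Real.log_exp, neg_neg]

variable [L.IsContMDiff 𝓘(ℂ, Cn n) ω] [CompactSpace X] {φ : LineMetric L}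
  {q : ∀ k, Sections (n := n) L k → ℝ} {b : BasisSeq n L} {f : ℝ → ℝ} {θ : ℕ}

theorem isBoundedGradedNorm_envRescaleSeq (hφc : φ.IsContinuous) (hφp : φ.IsPositive n)
    (hq : IsBoundedGradedNANorm L q) (hbq : ∀ k, IsNAOrthogonal (b k) (q k))
    (hfc : ConvexOn ℝ (rescaleDomain q b) f) (hfa : AntitoneOn f (rescaleDomain q b))
    (hfb : ∃ M : ℝ, ∀ t ∈ rescaleDomain q b, |f t| ≤ M) :
    IsBoundedGradedNorm L (envRescaleSeq θ (fun k => supNorm φ k) q b f) := by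
  obtain ⟨K, hK0, hK⟩ := exists_modNA_bounds hq hbq hfa hfb θ
  have hsup := fun k => isNorm_supNorm (n := n) hφc k
  have hmod := modNA_nonneg θ q b f
  -- At `k = 0` both exponential bounds equal `1`.
  have hq0 : ∀ s : Sections (n := n) L 0, s ≠ 0 → q 0 s = 1 := fun s hs => by
    obtain ⟨δ, -, h⟩ := hq.bounded
    have := h 0 s hs
    simp only [Nat.cast_zero, mul_zero, neg_zero, Real.exp_zero] at this
    exact le_antisymm this.2 this.1
  have hnorm : ∀ k, IsNorm (envRescaleSeq θ (fun k => supNorm φ k) q b f k) := fun k =>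
    isNorm_envRescale (hsup k) (hmod k) (fun c hc v => naNorm_smul _ _ hc v)
      (Real.exp_pos (-(K * k))) fun v hv => (hK k v hv).1
  refine ⟨hnorm, isSubmul_envRescale (isSubmul_supNorm hφc)
    (isSubmul_modNA hq.norm hq.submul hq0 hbq hfc hfa) (fun k => (hsup k).nonneg) hmod,
    φ, hφc.isBdd, hφp, dInfSeq_lt_top hK0 fun k s hs => ?_⟩
  have hs0 := (hsup k).pos hs
  have he0 := (hnorm k).pos hs
  have hlow : Real.exp (-(K * k)) * supNorm φ k s ≤
      envRescaleSeq θ (fun k => supNorm φ k) q b f k s := by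
    refine mul_le_envRescale (hsup k) (Real.exp_pos _).le (fun v => ?_) s
    by_cases hv : v = 0
    · simp [hv, ((hsup k).eq_zero_iff 0).2 rfl]
    · rw [mul_comm]
      exact mul_le_mul_of_nonneg_left (hK k v hv).1 ((hsup k).nonneg v)
  have hupp : envRescaleSeq θ (fun k => supNorm φ k) q b f k s ≤
      supNorm φ k s * Real.exp (K * k) :=
    (envRescale_le (hsup k).nonneg (hmod k) s).trans
      (mul_le_mul_of_nonneg_left (hK k s hs).2 hs0.le)
  rw [abs_le, Real.le_log_iff_exp_le (div_pos hs0 he0), Real.log_le_iff_le_exp (div_pos hs0 he0),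
    le_div_iff₀ he0, div_le_iff₀ he0, Real.exp_neg]
  rw [Real.exp_neg] at hlow
  exact ⟨by rwa [inv_mul_le_iff₀ (Real.exp_pos _), mul_comm],
    by rwa [inv_mul_le_iff₀ (Real.exp_pos _)] at hlow⟩

variable [IsManifold 𝓘(ℂ, Cn n) ω X] [MeasurableSpace X] [BorelSpace X] {dV : Measure X}

theorem isNorm_hermRescaleSeq (hdV : IsSmoothVolume n dV) (hφ : φ.IsContinuous) (k : ℕ) :
    IsNorm (hermRescaleSeq θ (fun k => l2Norm dV φ k) q b f k) :=
  isNorm_hermRescale (b k) (fun i => l2Norm_pos hdV hφ ((b k).ne_zero i)) _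

theorem isBernsteinMarkov_hermRescaleSeq (hdV : IsSmoothVolume n dV) (hφ : φ.IsContinuous)
    (hb : ∀ k, IsHermOrthogonal (b k) (l2Norm dV φ k)) :
    IsBernsteinMarkov L (envRescaleSeq θ (fun k => supNorm φ k) q b f)
      (hermRescaleSeq θ (fun k => l2Norm dV φ k) q b f) := by
  intro ε hε
  have := hdV.isFiniteMeasure
  -- Half of `ε`, because the estimate enters twice: for the sup-norms of the basis vectors and for
  -- the square root of the dimension.
  obtain ⟨C, hC1, hC⟩ := exists_pointNorm_le (L := L) hdV hφ (half_pos hε)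
  set v := √(dV.real univ)
  have hv : 0 ≤ v := Real.sqrt_nonneg _
  have hC0 : 0 < C := one_pos.trans hC1
  have hK1 : 1 < 2 + v + v * C ^ 2 := by
    have : 0 ≤ v * C ^ 2 := by positivity
    linarith
  -- The term `v * C ^ 2` serves the lower inequality, `v` the upper one, and `2` makes the constant
  -- exceed `1`.
  refine ⟨2 + v + v * C ^ 2, hK1, fun k s => ?_⟩
  set K := 2 + v + v * C ^ 2
  have hK0 : 0 < K := one_pos.trans hK1
  have hherm := isNorm_hermRescaleSeq (θ := θ) (q := q) (b := b) (f := f) hdV hφ k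
  have hsup := isNorm_supNorm (n := n) hφ k
  have hmod := modNA_nonneg θ q b f
  have hl2 : ∀ s : Sections (n := n) L k, 0 ≤ l2Norm dV φ k s := fun s => Real.sqrt_nonneg _
  set a : Fin (Module.finrank ℂ (Sections (n := n) L k)) → ℝ := fun i =>
    -Real.log (q k (b k i) ^ θ * Real.exp (k * f (jump q b k i))) with ha
  set D := C * Real.exp (ε / 2 * k) with hD
  have hD0 : 0 < D := by positivity
  have hD2 : D ^ 2 = C ^ 2 * Real.exp (ε * k) := by
    rw [hD, mul_pow, ← Real.exp_nat_mul]
    congr 2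
    push_cast
    ring
  have hsupl2 : ∀ s, supNorm φ k s ≤ D * l2Norm dV φ k s := fun s =>
    supNorm_le φ (mul_nonneg hD0.le (hl2 s)) (hC k s)
  constructor
  -- The competitor in the envelope is the expansion of `s` in the basis, on whose nonzero terms the
  -- modified norm is exactly `exp (-a i)`.
  · have hsum : envRescaleSeq θ (fun k => supNorm φ k) q b f k s ≤
        ∑ i, D * (‖(b k).repr s i‖ * (l2Norm dV φ k (b k i) * Real.exp (-a i))) := by
      conv_lhs => rw [← (b k).sum_repr s]
      refine (envRescale_le_sum hsup.nonneg (hmod k) _).trans (Finset.sum_le_sum fun i _ => ?_)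
      rw [hsup.smul]
      by_cases h0 : (b k).repr s i = 0
      · simp [h0]
      · have h1 : modNA θ q b f k ((b k).repr s i • b k i) = Real.exp (-a i) := by
          rw [modNA, naNorm_smul _ _ h0, naNorm_basis]
        rw [h1]
        calc ‖(b k).repr s i‖ * supNorm φ k (b k i) * Real.exp (-a i)
            ≤ ‖(b k).repr s i‖ * (D * l2Norm dV φ k (b k i)) * Real.exp (-a i) := by
              gcongr
              exact hsupl2 _
          _ = _ := by ring
    rw [← Finset.mul_sum] at hsum
    have hcs := sum_mul_le_sqrt_mul_hermRescale (b k) (l2Norm dV φ k) a s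
    have hN : √(Module.finrank ℂ (Sections (n := n) L k) : ℝ) ≤ v * D := by
      rw [← Real.sqrt_sq hD0.le, ← Real.sqrt_mul measureReal_nonneg]
      exact Real.sqrt_le_sqrt (card_le_of_pointNorm_le hdV hφ (b k) (hb k) (hC k))
    have hfin : envRescaleSeq θ (fun k => supNorm φ k) q b f k s ≤
        K * Real.exp (ε * k) * hermRescaleSeq θ (fun k => l2Norm dV φ k) q b f k s := by
      rw [hermRescaleSeq_eq]
      have hh := hermRescale_nonneg (b k) (l2Norm dV φ k) a s
      calc _ ≤ D * (√(Module.finrank ℂ (Sections (n := n) L k) : ℝ) *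
              hermRescale (b k) (l2Norm dV φ k) a s) :=
            hsum.trans (mul_le_mul_of_nonneg_left hcs hD0.le)
        _ ≤ D * (v * D * hermRescale (b k) (l2Norm dV φ k) a s) := by gcongr
        _ = v * C ^ 2 * Real.exp (ε * k) * hermRescale (b k) (l2Norm dV φ k) a s := by
            linear_combination v * hermRescale (b k) (l2Norm dV φ k) a s * hD2
        _ ≤ _ := by
            refine mul_le_mul_of_nonneg_right (mul_le_mul_of_nonneg_right ?_ (Real.exp_pos _).le) hh
            linarith
    rwa [Real.exp_neg, ← mul_inv, inv_mul_le_iff₀ (by positivity)]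
  · have h1 : 1 ≤ Real.exp (ε * k) := Real.one_le_exp (by positivity)
    have h2 : K⁻¹ * hermRescaleSeq θ (fun k => l2Norm dV φ k) q b f k s ≤
        envRescaleSeq θ (fun k => supNorm φ k) q b f k s := by
      -- It suffices to compare with the product of the sup-norm and the modified norm on single
      -- sections; there the finite total volume bounds the `L²`-norm by the sup-norm.
      refine mul_le_envRescale hherm (inv_nonneg.2 hK0.le) (fun w => ?_) s
      rw [inv_mul_le_iff₀ hK0, hermRescaleSeq_eq]
      refine (hermRescale_le_mul (b k) hl2 (hb k) a w).trans ?_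
      rw [← mul_assoc]
      refine mul_le_mul_of_nonneg_right ((l2Norm_le_mul_supNorm hφ w).trans ?_) (hmod k w)
      refine mul_le_mul_of_nonneg_right ?_ (hsup.nonneg w)
      have : 0 ≤ v * C ^ 2 := by positivity
      linarith
    rw [inv_mul_le_iff₀ hK0] at h2
    refine h2.trans (mul_le_mul_of_nonneg_right ?_ (envRescale_nonneg hsup.nonneg (hmod k) s))
    exact le_mul_of_one_le_right hK0.le h1

end Main

end Graded

end Quantisation

theorem theorem3p2 {n : ℕ} {X : Type*} [TopologicalSpace X] [ChartedSpace (Cn n) X]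
    [IsManifold 𝓘(ℂ, Cn n) ω X] [CompactSpace X] [T2Space X] [ConnectedSpace X]
    [MeasurableSpace X] [BorelSpace X]
    {ι : Type*} (L : VectorBundleCore ℂ X ℂ ι) [L.IsContMDiff 𝓘(ℂ, Cn n) ω]
    (hL : IsAmple (n := n) L)
    (dV : Measure X) (hdV : IsSmoothVolume n dV)
    (φ : LineMetric L) (hφc : φ.IsContinuous) (hφp : φ.IsPositive n)
    (q : ∀ k, Sections (n := n) L k → ℝ)
    (hq : IsBoundedGradedNANorm L q)
    (b : BasisSeq n L)
    (hbq : ∀ k, IsNAOrthogonal (b k) (q k))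
    (f : ℝ → ℝ) (hfc : ConvexOn ℝ (rescaleDomain q b) f)
    (hfa : AntitoneOn f (rescaleDomain q b))
    (hfb : ∃ M : ℝ, ∀ t ∈ rescaleDomain q b, |f t| ≤ M)
    (θ : ℕ) (hθ : θ = 0 ∨ θ = 1) :
    IsBoundedGradedNorm L
        (envRescaleSeq θ (fun k => supNorm φ k) q b f) ∧
      ((∀ k, IsHermOrthogonal (b k) (l2Norm dV φ k)) →
        (∀ k, IsNorm
            (hermRescaleSeq θ (fun k => l2Norm dV φ k) q b f k) ∧
          IsHermOrthogonal (b k)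
            (hermRescaleSeq θ (fun k => l2Norm dV φ k) q b f k)) ∧
        IsBernsteinMarkov L
          (envRescaleSeq θ (fun k => supNorm φ k) q b f)
          (hermRescaleSeq θ (fun k => l2Norm dV φ k) q b f)) := by
  refine ⟨isBoundedGradedNorm_envRescaleSeq hφc hφp hq hbq hfc hfa hfb, fun hb => ⟨fun k =>
    ⟨isNorm_hermRescaleSeq hdV hφc k, ?_⟩, isBernsteinMarkov_hermRescaleSeq hdV hφc hb⟩⟩
  rw [hermRescaleSeq_eq]
  exact isHermOrthogonal_hermRescale _ _ _
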